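/- Let $n\ge 1$, let $D_n=\mathbb{C}\langle x_1,\dots,x_n,\partial_1,\dots,\partial_n\rangle$ be the $n$-th Weyl algebra over $\mathbb{C}$, and let $w\in\mathbb{R}^n$ be a weight with $0<w_i\le w_n$ for all $i$. For $k\in\mathbb{R}$ let $V_kD_n$ be the span of the monomials $x^\alpha\partial^\beta$ with $w\cdot(\beta-\alpha)\le k$. Let $M$ be a finitely generated (equivalently, coherent) left $D_n$-module with a good filtration $U_\bullet M$ with respect to $V_\bullet D_n$: there are $m_1,\dots,m_s\in M$ and $k_1,\dots,k_s\in\mathbb{R}$ such that $U_kM=\sum_j (V_{k-k_j}D_n)\,m_j$ for all $k\in\mathbb{R}$. Put $U_{<k}M=\bigcup_{j<k}U_jM$ and $\mathrm{gr}^U(M)=\bigoplus_{k\in\mathbb{R}}U_kM/U_{<k}M$. This is a module over $\mathrm{gr}^VD_n\cong D_n$: $x_i$ maps degree $k$ to degree $k-w_i$, and $\partial_i$ maps degree $k$ to degree $k+w_i$. Let $i\colon\mathbb{C}^{n-1}\hookrightarrow\mathbb{C}^n$ be the inclusion $(x_1,\dots,x_{n-1})\mapsto(x_1,\dots,x_{n-1},0)$,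 with image $Z=\{x_n=0\}$. For a $D_n$-module $N$ let $i^*N=N/x_nN$, a $D_{n-1}$-module. Equip $i^*M$ with the filtration in which $U_k(i^*M)=U_kM/(x_nM\cap U_kM)$ is the image of $U_kM$; this is a filtration with respect to the weight $(w_1,\dots,w_{n-1})$. Suppose that $i$ is non-characteristic for $M$ in a neighbourhood of the origin, that is, over some Zariski open neighbourhood of the origin, $T^*_Z\mathbb{C}^n\cap\mathrm{Ch}(M)$ is contained in the zero section of $T^*\mathbb{C}^n$, where $\mathrm{Ch}(M)$ is the characteristic variety of $M$. Then there is a (unique) isomorphism of $D_{n-1}$-modules $$\mathrm{gr}^U(i^*M)\;\xrightarrow{\ \sim\ }\;i^*\mathrm{gr}^U(M)$$ which, for all $k\in\mathbb{R}$ and $m\in U_kM$, maps the class in degree $k$ of the image of $m$ in $i^*M$ to the image in $i^*\mathrm{gr}^U(M)$ of the class of $m$ in degree $k$. (It is an isomorphism on all of $\mathbb{C}^{n-1}$, and in particular in a neighbourhood of the origin.) -/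

import Mathlib

/-! ## The Weyl algebra `D_n` -/

/-- The defining relations of the Weyl algebra on the generators `x_i` (`Sum.inl i`) and
`∂_i` (`Sum.inr i`). -/
inductive WeylRel (n : ℕ) :
    FreeAlgebra ℂ (Fin n ⊕ Fin n) → FreeAlgebra ℂ (Fin n ⊕ Fin n) → Prop
  | xx (i j : Fin n) : WeylRel n
      (FreeAlgebra.ι ℂ (Sum.inl i) * FreeAlgebra.ι ℂ (Sum.inl j))
      (FreeAlgebra.ι ℂ (Sum.inl j) * FreeAlgebra.ι ℂ (Sum.inl i))
  | dd (i j : Fin n) : WeylRel n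
      (FreeAlgebra.ι ℂ (Sum.inr i) * FreeAlgebra.ι ℂ (Sum.inr j))
      (FreeAlgebra.ι ℂ (Sum.inr j) * FreeAlgebra.ι ℂ (Sum.inr i))
  | dx (i j : Fin n) : WeylRel n
      (FreeAlgebra.ι ℂ (Sum.inr i) * FreeAlgebra.ι ℂ (Sum.inl j))
      (FreeAlgebra.ι ℂ (Sum.inl j) * FreeAlgebra.ι ℂ (Sum.inr i) + if i = j then 1 else 0)

/-- The `n`th Weyl algebra `D_n` over `ℂ`. -/
def Weyl (n : ℕ) : Type := RingQuot (WeylRel n)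

namespace Weyl

noncomputable instance (n : ℕ) : Ring (Weyl n) := inferInstanceAs (Ring (RingQuot (WeylRel n)))

noncomputable instance (n : ℕ) : Algebra ℂ (Weyl n) :=
  inferInstanceAs (Algebra ℂ (RingQuot (WeylRel n)))

/-- The quotient map from the free algebra. -/
noncomputable def proj (n : ℕ) : FreeAlgebra ℂ (Fin n ⊕ Fin n) →ₐ[ℂ] Weyl n :=
  RingQuot.mkAlgHom ℂ (WeylRel n)

/-- The coordinate `x_i`. -/
noncomputable def x {n : ℕ} (i : Fin n) : Weyl n := proj n (FreeAlgebra.ι ℂ (Sum.inl i))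

/-- The derivation `∂_i`. -/
noncomputable def d {n : ℕ} (i : Fin n) : Weyl n := proj n (FreeAlgebra.ι ℂ (Sum.inr i))

theorem x_comm {n : ℕ} (i j : Fin n) : (x i * x j : Weyl n) = x j * x i := by
  have h := RingQuot.mkAlgHom_rel ℂ (WeylRel.xx (n := n) i j)
  rw [map_mul, map_mul] at h
  exact h

theorem d_comm {n : ℕ} (i j : Fin n) : (d i * d j : Weyl n) = d j * d i := by
  have h := RingQuot.mkAlgHom_rel ℂ (WeylRel.dd (n := n) i j)
  rw [map_mul, map_mul] at h
  exact h

theorem d_mul_x {n : ℕ} (i j : Fin n) :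
    (d i * x j : Weyl n) = x j * d i + if i = j then 1 else 0 := by
  have h := RingQuot.mkAlgHom_rel ℂ (WeylRel.dx (n := n) i j)
  rw [map_add, map_mul, map_mul] at h
  refine h.trans ?_
  split_ifs
  · rw [map_one]; rfl
  · rw [map_zero]; rfl

/-- The universal property of the Weyl algebra. -/
noncomputable def lift {n : ℕ} {A : Type*} [Ring A] [Algebra ℂ A] (X Δ : Fin n → A)
    (hXX : ∀ i j, X i * X j = X j * X i) (hDD : ∀ i j, Δ i * Δ j = Δ j * Δ i)
    (hDX : ∀ i j, Δ i * X j = X j * Δ i + if i = j then 1 else 0) : Weyl n →ₐ[ℂ] A :=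
  RingQuot.liftAlgHom ℂ ⟨FreeAlgebra.lift ℂ (Sum.elim X Δ), by
    intro a b h
    cases h with
    | xx i j => simpa using hXX i j
    | dd i j => simpa using hDD i j
    | dx i j =>
      have h := hDX i j
      split_ifs at h ⊢ <;> simpa using h⟩

section lift

variable {n : ℕ} {A : Type*} [Ring A] [Algebra ℂ A] (X Δ : Fin n → A)
  (hXX : ∀ i j, X i * X j = X j * X i) (hDD : ∀ i j, Δ i * Δ j = Δ j * Δ i)
  (hDX : ∀ i j, Δ i * X j = X j * Δ i + if i = j then 1 else 0)

theorem lift_x (i : Fin n) : lift X Δ hXX hDD hDX (x i) = X i := by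
  refine (RingQuot.liftAlgHom_mkAlgHom_apply ℂ _ _ _).trans ?_
  simp

theorem lift_d (i : Fin n) : lift X Δ hXX hDD hDX (d i) = Δ i := by
  refine (RingQuot.liftAlgHom_mkAlgHom_apply ℂ _ _ _).trans ?_
  simp

end lift

/-- A property of elements of `D_n` holds for all of them if it holds for scalars, for the
generators, and is stable under sums and products. -/
theorem induction {n : ℕ} {p : Weyl n → Prop} (hc : ∀ c : ℂ, p (algebraMap ℂ (Weyl n) c))
    (hx : ∀ i, p (x i)) (hd : ∀ i, p (d i)) (hadd : ∀ a b, p a → p b → p (a + b))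
    (hmul : ∀ a b, p a → p b → p (a * b)) (P : Weyl n) : p P := by
  obtain ⟨a, rfl⟩ : ∃ a, proj n a = P := RingQuot.mkAlgHom_surjective ℂ (WeylRel n) P
  refine FreeAlgebra.induction ℂ _ (motive := fun a => p (proj n a)) ?_ ?_ ?_ ?_ a
  · intro c; rw [AlgHom.commutes]; exact hc c
  · rintro (i | i)
    · exact hx i
    · exact hd i
  · intro a b ha hb; rw [map_mul]; exact hmul _ _ ha hb
  · intro a b ha hb; rw [map_add]; exact hadd _ _ ha hb

/-- The monomial `x^α = x_1^{α_1} ⋯ x_n^{α_n}`. -/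
noncomputable def xPow {n : ℕ} (α : Fin n → ℕ) : Weyl n := (List.ofFn fun i => x i ^ α i).prod

/-- The monomial `∂^β = ∂_1^{β_1} ⋯ ∂_n^{β_n}`. -/
noncomputable def dPow {n : ℕ} (β : Fin n → ℕ) : Weyl n := (List.ofFn fun i => d i ^ β i).prod

/-- The `V`-filtration of `D_n` with respect to the weight `w`, indexed by the real numbers:
`V_k D_n` is the space of those `P = ∑ c_{αβ} x^α ∂^β` such that `w·(β - α) ≤ k` whenever
`c_{αβ} ≠ 0`. -/
noncomputable def V {n : ℕ} (w : Fin n → ℝ) (k : ℝ) : Submodule ℂ (Weyl n) :=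
  Submodule.span ℂ {P | ∃ α β : Fin n → ℕ,
    ∑ i, w i * ((β i : ℝ) - (α i : ℝ)) ≤ k ∧ P = xPow α * dPow β}

/-- The filtration of `D_n` by the order of differential operators:
`F_p D_n` is spanned by the `x^α ∂^β` with `|β| ≤ p`. -/
noncomputable def orderFiltration (n : ℕ) (p : ℤ) : Submodule ℂ (Weyl n) :=
  Submodule.span ℂ {P | ∃ α β : Fin n → ℕ, ∑ i, (β i : ℤ) ≤ p ∧ P = xPow α * dPow β}

/-- Normal ordering `∑ c_{αβ} x^α ξ^β ↦ ∑ c_{αβ} x^α ∂^β`, where the variables of the polynomial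
ring `ℂ[x, ξ]` are `x_i = Sum.inl i` and `ξ_i = Sum.inr i`. If `q` is homogeneous of degree `d`
in `ξ`, then `normalOrder n q` is an operator in `F_d D_n` with principal symbol `q`. -/
noncomputable def normalOrder (n : ℕ) : MvPolynomial (Fin n ⊕ Fin n) ℂ →ₗ[ℂ] Weyl n :=
  (MvPolynomial.basisMonomials (Fin n ⊕ Fin n) ℂ).constr ℂ
    fun s => xPow (fun i => s (Sum.inl i)) * dPow (fun i => s (Sum.inr i))

end Weyl

/-- `F` is a good filtration of the `D_n`-module `M`, where `D_n` is filtered by `R`: there are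
`m_1, …, m_s ∈ M` and shifts `k_1, …, k_s` with
`F_p = R_{p - k_1} m_1 + ⋯ + R_{p - k_s} m_s` for all `p`. -/
def IsGoodFiltration {n : ℕ} {ι : Type*} [AddCommGroup ι] (R : ι → Submodule ℂ (Weyl n))
    {M : Type*} [AddCommGroup M] [Module ℂ M] [Module (Weyl n) M] [IsScalarTower ℂ (Weyl n) M]
    (F : ι → Submodule ℂ M) : Prop :=
  ∃ (s : ℕ) (m : Fin s → M) (k : Fin s → ι), ∀ p : ι,
    F p = ⨆ j, (R (p - k j)).map ((LinearMap.toSpanSingleton (Weyl n) M (m j)).restrictScalars ℂ)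

/-! ## Characteristic varieties -/

/-- The characteristic variety `Ch(M) ⊆ T^*ℂ^n = ℂ^n × ℂ^n` of a finitely generated `D_n`-module:
the zero locus of the annihilator in `gr^F D_n = ℂ[x, ξ]` of `gr^F M`, for a good exhaustive
filtration `F` of `M` with respect to the order filtration. (It does not depend on the choice
of `F`. The annihilator is a homogeneous ideal with respect to the degree in `ξ`; an element `q`
of degree `d` annihilates `gr^F M` exactly if an operator with principal symbol `q`
maps `F_p M` to `F_{p+d-1} M` for all `p`.) -/
def charVariety (n : ℕ) (M : Type*) [AddCommGroup M] [Module ℂ M] [Module (Weyl n) M]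
    [IsScalarTower ℂ (Weyl n) M] : Set ((Fin n → ℂ) × (Fin n → ℂ)) :=
  {z | ∃ F : ℤ → Submodule ℂ M, IsGoodFiltration (Weyl.orderFiltration n) F ∧ (⨆ p, F p) = ⊤ ∧
    ∀ (d : ℕ) (q : MvPolynomial (Fin n ⊕ Fin n) ℂ),
      MvPolynomial.IsWeightedHomogeneous
        (Sum.elim (fun _ => 0) (fun _ => 1) : Fin n ⊕ Fin n → ℕ) q d →
      (∀ p : ℤ, ∀ m ∈ F p, Weyl.normalOrder n q • m ∈ F (p + d - 1)) →
      MvPolynomial.eval (Sum.elim z.1 z.2) q = 0}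

/-- The conormal bundle `T^*_Z X` of the hyperplane `Z = {x_{n+1} = 0}` in `X = ℂ^{n+1}`. -/
def conormalHyperplane (n : ℕ) : Set ((Fin (n + 1) → ℂ) × (Fin (n + 1) → ℂ)) :=
  {z | z.1 (Fin.last n) = 0 ∧ ∀ i : Fin n, z.2 i.castSucc = 0}

/-- The inclusion of `Z = {x_{n+1} = 0}` in `X = ℂ^{n+1}` is non-characteristic for `M` in a
(Zariski open) neighbourhood of the origin: over this neighbourhood, `T^*_Z X ∩ Ch(M)` is contained
in the zero section of `T^*X`. -/
def NonCharacteristicNearOrigin (n : ℕ) (M : Type*) [AddCommGroup M] [Module ℂ M]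
    [Module (Weyl (n + 1)) M] [IsScalarTower ℂ (Weyl (n + 1)) M] : Prop :=
  ∃ g : MvPolynomial (Fin (n + 1)) ℂ, MvPolynomial.eval 0 g ≠ 0 ∧
    ∀ z ∈ conormalHyperplane n ∩ charVariety (n + 1) M,
      MvPolynomial.eval z.1 g ≠ 0 → z.2 = 0

/-! ## Filtered modules and associated graded modules -/

/-- A filtration `U_• M` of a `D_n`-module `M` with respect to the filtration `V_• D_n` of weight
`w`, indexed by the real numbers. -/
structure VFiltration {n : ℕ} (w : Fin n → ℝ) (M : Type*) [AddCommGroup M] [Module ℂ M]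
    [Module (Weyl n) M] where
  /-- The subspace `U_k M`. -/
  U : ℝ → Submodule ℂ M
  mono : Monotone U
  smul_mem : ∀ {k l : ℝ} {P : Weyl n} {m : M}, P ∈ Weyl.V w k → m ∈ U l → P • m ∈ U (k + l)

/-- The space `M[T^ℝ] = ⨁_{k ∈ ℝ} M T^k` of formal sums `∑ m_k T^k`, on which `D_n` acts by
`x_i (m T^k) = (x_i m) T^{k - w_i}` and `∂_i (m T^k) = (∂_i m) T^{k + w_i}`. -/
def GradedSums {n : ℕ} (_w : Fin n → ℝ) (M : Type*) [AddCommGroup M] : Type _ := ℝ →₀ M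

namespace GradedSums

set_option linter.unusedSectionVars false

variable {n : ℕ} (w : Fin n → ℝ) (M : Type*) [AddCommGroup M] [Module ℂ M] [Module (Weyl n) M]
  [IsScalarTower ℂ (Weyl n) M]

noncomputable instance : AddCommGroup (GradedSums w M) := inferInstanceAs (AddCommGroup (ℝ →₀ M))

noncomputable instance : Module ℂ (GradedSums w M) := inferInstanceAs (Module ℂ (ℝ →₀ M))

/-- The operator `m T^k ↦ (P m) T^{k + c}`. -/
noncomputable def shift (c : ℝ) (P : Weyl n) : Module.End ℂ (ℝ →₀ M) :=
  Finsupp.lmapDomain M ℂ (fun k => k + c) ∘ₗ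
    Finsupp.mapRange.linearMap (Algebra.lsmul ℂ ℂ M P)

theorem shift_single (c : ℝ) (P : Weyl n) (k : ℝ) (m : M) :
    shift M c P (Finsupp.single k m) = Finsupp.single (k + c) (P • m) := by
  simp [shift, Finsupp.mapDomain_single]

theorem shift_mul (c c' : ℝ) (P P' : Weyl n) :
    shift M c P * shift M c' P' = shift M (c + c') (P * P') := by
  refine Finsupp.lhom_ext fun k m => ?_
  rw [Module.End.mul_apply, shift_single, shift_single, shift_single, mul_smul,
    add_comm c c', add_assoc]

theorem shift_add (c : ℝ) (P P' : Weyl n) :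
    shift M c (P + P') = shift M c P + shift M c P' := by
  refine Finsupp.lhom_ext fun k m => ?_
  rw [LinearMap.add_apply, shift_single, shift_single, shift_single, add_smul, Finsupp.single_add]

theorem shift_one : shift M 0 (1 : Weyl n) = 1 := by
  refine Finsupp.lhom_ext fun k m => ?_
  rw [shift_single, add_zero, one_smul, Module.End.one_apply]

theorem shift_zero (c : ℝ) : shift M c (0 : Weyl n) = 0 := by
  refine Finsupp.lhom_ext fun k m => ?_
  rw [shift_single, zero_smul, Finsupp.single_zero, LinearMap.zero_apply]

/-- The action of `D_n` on `M[T^ℝ]`. -/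
noncomputable def action : Weyl n →ₐ[ℂ] Module.End ℂ (ℝ →₀ M) :=
  Weyl.lift (fun i => shift M (-w i) (Weyl.x i)) (fun i => shift M (w i) (Weyl.d i))
    (fun i j => by rw [shift_mul, shift_mul, Weyl.x_comm, add_comm])
    (fun i j => by rw [shift_mul, shift_mul, Weyl.d_comm, add_comm])
    (fun i j => by
      rw [shift_mul, shift_mul, Weyl.d_mul_x, shift_add, add_comm (-w j)]
      congr 1
      split_ifs with h
      · subst h; rw [add_neg_cancel, shift_one]
      · rw [shift_zero])

noncomputable instance : Module (Weyl n) (GradedSums w M) :=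
  Module.compHom (ℝ →₀ M) (action w M).toRingHom

instance : IsScalarTower ℂ (Weyl n) (GradedSums w M) where
  smul_assoc c P f := by
    change action w M (c • P) f = c • action w M P f
    rw [map_smul]; rfl

/-- The formal sum `m T^k`. -/
noncomputable def single (k : ℝ) : M →ₗ[ℂ] GradedSums w M := Finsupp.lsingle k

variable {M}

/-- The coefficient of `T^k`. -/
noncomputable def coeff (k : ℝ) : GradedSums w M →ₗ[ℂ] M := Finsupp.lapply k

theorem coeff_single_same (k : ℝ) (m : M) : coeff w k (single w M k m) = m :=
  Finsupp.single_eq_same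

theorem coeff_single_of_ne {k l : ℝ} (h : l ≠ k) (m : M) : coeff w l (single w M k m) = 0 :=
  Finsupp.single_eq_of_ne h

theorem x_smul_single (i : Fin n) (k : ℝ) (m : M) :
    Weyl.x i • single w M k m = single w M (k - w i) (Weyl.x i • m) := by
  change action w M (Weyl.x i) (Finsupp.single k m) = _
  rw [action, Weyl.lift_x, shift_single]; rfl

theorem d_smul_single (i : Fin n) (k : ℝ) (m : M) :
    Weyl.d i • single w M k m = single w M (k + w i) (Weyl.d i • m) := by
  change action w M (Weyl.d i) (Finsupp.single k m) = _
  rw [action, Weyl.lift_d, shift_single]; rfl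

theorem coeff_shift (c : ℝ) (P : Weyl n) (f : ℝ →₀ M) (k : ℝ) :
    shift M c P f (k + c) = P • f k := by
  change Finsupp.mapDomain (fun k => k + c) _ (k + c) = _
  rw [Finsupp.mapDomain_apply (add_left_injective c)]
  rfl

theorem coeff_x_smul (i : Fin n) (f : GradedSums w M) (k : ℝ) :
    coeff w k (Weyl.x i • f) = Weyl.x i • coeff w (k + w i) f := by
  change action w M (Weyl.x i) f k = _
  rw [action, Weyl.lift_x]
  have h := coeff_shift (-w i) (Weyl.x i) f (k + w i)
  rwa [add_neg_cancel_right] at h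

theorem coeff_d_smul (i : Fin n) (f : GradedSums w M) (k : ℝ) :
    coeff w k (Weyl.d i • f) = Weyl.d i • coeff w (k - w i) f := by
  change action w M (Weyl.d i) f k = _
  rw [action, Weyl.lift_d]
  have h := coeff_shift (w i) (Weyl.d i) f (k - w i)
  rwa [sub_add_cancel] at h

/-- If a family of subspaces `S_k ⊆ M` satisfies `x_i S_k ⊆ S_{k - w_i}` and
`∂_i S_k ⊆ S_{k + w_i}`, then `⨁ S_k T^k` is a `D_n`-submodule of `M[T^ℝ]`. -/
noncomputable def sub (S : ℝ → Submodule ℂ M)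
    (hx : ∀ i k, ∀ m ∈ S k, (Weyl.x i : Weyl n) • m ∈ S (k - w i))
    (hd : ∀ i k, ∀ m ∈ S k, (Weyl.d i : Weyl n) • m ∈ S (k + w i)) :
    Submodule (Weyl n) (GradedSums w M) where
  carrier := {f | ∀ k, coeff w k f ∈ S k}
  add_mem' ha hb k := by rw [map_add]; exact add_mem (ha k) (hb k)
  zero_mem' k := by rw [map_zero]; exact zero_mem _
  smul_mem' P := by
    refine Weyl.induction (p := fun P => ∀ {f : GradedSums w M}, (∀ k, coeff w k f ∈ S k) →
      ∀ k, coeff w k (P • f) ∈ S k) ?_ ?_ ?_ ?_ ?_ P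
    · intro c f hf k
      rw [algebraMap_smul, map_smul]
      exact (S k).smul_mem c (hf k)
    · intro i f hf k
      rw [coeff_x_smul]
      simpa using hx i _ _ (hf (k + w i))
    · intro i f hf k
      rw [coeff_d_smul]
      simpa using hd i _ _ (hf (k - w i))
    · intro a b ha hb f hf k
      rw [add_smul, map_add]
      exact add_mem (ha hf k) (hb hf k)
    · intro a b ha hb f hf k
      rw [mul_smul]
      exact ha (hb hf) k

end GradedSums

namespace Weyl

theorem prod_ofFn_eq_single {A : Type*} [Monoid A] {n : ℕ} (f : Fin n → A) (i : Fin n)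
    (h : ∀ j, j ≠ i → f j = 1) : (List.ofFn f).prod = f i := by
  induction n with
  | zero => exact i.elim0
  | succ n ih =>
    rw [List.ofFn_succ, List.prod_cons]
    refine Fin.cases (motive := fun i => (∀ j, j ≠ i → f j = 1) →
      f 0 * (List.ofFn fun j : Fin n => f j.succ).prod = f i) ?_ ?_ i h
    · intro h
      have : (fun j : Fin n => f j.succ) = fun _ => 1 :=
        funext fun j => h _ (Fin.succ_ne_zero j)
      rw [this]
      simp
    · intro i h
      rw [h 0 (Fin.succ_ne_zero i).symm, one_mul]
      exact ih (fun j => f j.succ) i fun j hj => h _ fun hh => hj (Fin.succ_injective _ hh)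

theorem x_mem_V {n : ℕ} (w : Fin n → ℝ) (i : Fin n) : (x i : Weyl n) ∈ V w (-w i) := by
  refine Submodule.subset_span ⟨Pi.single i 1, 0, ?_, ?_⟩
  · refine le_of_eq ?_
    rw [Finset.sum_eq_single i] <;> simp +contextual
  · rw [xPow, dPow, prod_ofFn_eq_single _ i] <;> simp +contextual

theorem d_mem_V {n : ℕ} (w : Fin n → ℝ) (i : Fin n) : (d i : Weyl n) ∈ V w (w i) := by
  refine Submodule.subset_span ⟨0, Pi.single i 1, ?_, ?_⟩
  · refine le_of_eq ?_
    rw [Finset.sum_eq_single i] <;> simp +contextual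
  · rw [xPow, dPow, prod_ofFn_eq_single (fun j => d j ^ _) i] <;> simp +contextual

/-- The inclusion `D_n → D_{n+1}`. -/
noncomputable def incl (n : ℕ) : Weyl n →ₐ[ℂ] Weyl (n + 1) :=
  lift (fun i => x i.castSucc) (fun i => d i.castSucc)
    (fun _ _ => x_comm _ _) (fun _ _ => d_comm _ _)
    (fun i j => by rw [d_mul_x]; simp only [Fin.castSucc_inj])

theorem incl_x {n : ℕ} (i : Fin n) : incl n (x i) = x i.castSucc := lift_x ..

theorem incl_d {n : ℕ} (i : Fin n) : incl n (d i) = d i.castSucc := lift_d ..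

theorem incl_mul_x_last {n : ℕ} (P : Weyl n) :
    incl n P * x (Fin.last n) = x (Fin.last n) * incl n P := by
  refine induction (p := fun P => incl n P * x (Fin.last n) = x (Fin.last n) * incl n P)
    ?_ ?_ ?_ ?_ ?_ P
  · intro c
    rw [AlgHom.commutes]
    exact Algebra.commutes _ _
  · intro i
    rw [incl_x, x_comm]
  · intro i
    rw [incl_d, d_mul_x, if_neg (Fin.castSucc_lt_last i).ne, add_zero]
  · intro a b ha hb
    rw [map_add, add_mul, mul_add, ha, hb]
  · intro a b ha hb
    rw [map_mul, mul_assoc, hb, ← mul_assoc, ha, mul_assoc]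

theorem incl_xPow {n : ℕ} (α : Fin n → ℕ) :
    incl n (xPow α) = xPow (Fin.snoc α 0 : Fin (n + 1) → ℕ) := by
  rw [xPow, xPow, map_list_prod, List.map_ofFn, List.ofFn_succ', List.concat_eq_append,
    List.prod_append]
  simp [Function.comp_def, incl_x]

theorem incl_dPow {n : ℕ} (β : Fin n → ℕ) :
    incl n (dPow β) = dPow (Fin.snoc β 0 : Fin (n + 1) → ℕ) := by
  rw [dPow, dPow, map_list_prod, List.map_ofFn, List.ofFn_succ', List.concat_eq_append,
    List.prod_append]
  simp [Function.comp_def, incl_d]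

theorem incl_mem_V {n : ℕ} (w : Fin (n + 1) → ℝ) {k : ℝ} {P : Weyl n}
    (hP : P ∈ V (fun i => w i.castSucc) k) : incl n P ∈ V w k := by
  have h : V (fun i : Fin n => w i.castSucc) k ≤ (V w k).comap (incl n).toLinearMap := by
    refine Submodule.span_le.2 ?_
    rintro _ ⟨α, β, h, rfl⟩
    refine Submodule.subset_span ⟨Fin.snoc α 0, Fin.snoc β 0, ?_, ?_⟩
    · rw [Fin.sum_univ_castSucc]
      simpa using h
    · rw [AlgHom.toLinearMap_apply, map_mul, incl_xPow, incl_dPow]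
  exact h hP

end Weyl

namespace VFiltration

section gr

variable {n : ℕ} {w : Fin n → ℝ} {M : Type*} [AddCommGroup M] [Module ℂ M] [Module (Weyl n) M]
  [IsScalarTower ℂ (Weyl n) M] (F : VFiltration w M)

/-- `U_{<k} M = ⋃_{j < k} U_j M`. -/
def lt (k : ℝ) : Submodule ℂ M := ⨆ j : Set.Iio k, F.U j

theorem smul_mem_lt {k l : ℝ} {P : Weyl n} {m : M} (hP : P ∈ Weyl.V w k) (hm : m ∈ F.lt l) :
    P • m ∈ F.lt (k + l) := by
  have h : F.lt l ≤ (F.lt (k + l)).comap (Algebra.lsmul ℂ ℂ M P) := by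
    refine iSup_le fun j m hm => ?_
    exact (le_iSup (fun j : Set.Iio (k + l) => F.U j)
      ⟨k + j, by have := j.2; simp only [Set.mem_Iio] at this ⊢; linarith⟩) (F.smul_mem hP hm)
  exact h hm

/-- `⨁_k U_k M · T^k`. -/
noncomputable def rees : Submodule (Weyl n) (GradedSums w M) :=
  GradedSums.sub w F.U
    (fun i k m hm => by
      rw [sub_eq_neg_add]; exact F.smul_mem (Weyl.x_mem_V w i) hm)
    (fun i k m hm => by
      rw [add_comm]; exact F.smul_mem (Weyl.d_mem_V w i) hm)

/-- `⨁_k U_{<k} M · T^k`. -/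
noncomputable def reesLT : Submodule (Weyl n) (GradedSums w M) :=
  GradedSums.sub w F.lt
    (fun i k m hm => by
      rw [sub_eq_neg_add]; exact F.smul_mem_lt (Weyl.x_mem_V w i) hm)
    (fun i k m hm => by
      rw [add_comm]; exact F.smul_mem_lt (Weyl.d_mem_V w i) hm)

/-- The associated graded module
`gr^U M = ⨁_k U_k M / U_{<k} M = (⨁_k U_k M · T^k) / (⨁_k U_{<k} M · T^k)`
with its structure of a module over `gr^V D_n ≅ D_n`: the generator `x_i` maps the class of
`m ∈ U_k M` in degree `k` to the class of `x_i m` in degree `k - w_i`, and `∂_i` maps it to the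
class of `∂_i m` in degree `k + w_i`. -/
def Gr : Type _ := F.rees ⧸ F.reesLT.submoduleOf F.rees

noncomputable instance : AddCommGroup F.Gr :=
  inferInstanceAs (AddCommGroup (F.rees ⧸ F.reesLT.submoduleOf F.rees))

noncomputable instance : Module (Weyl n) F.Gr :=
  inferInstanceAs (Module (Weyl n) (F.rees ⧸ F.reesLT.submoduleOf F.rees))

noncomputable instance : Module ℂ F.Gr :=
  inferInstanceAs (Module ℂ (F.rees ⧸ F.reesLT.submoduleOf F.rees))

instance : IsScalarTower ℂ (Weyl n) F.Gr :=
  inferInstanceAs (IsScalarTower ℂ (Weyl n) (F.rees ⧸ F.reesLT.submoduleOf F.rees))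

theorem single_mem_rees {k : ℝ} {m : M} (hm : m ∈ F.U k) :
    GradedSums.single w M k m ∈ F.rees := by
  intro l
  by_cases h : l = k
  · subst h
    rw [GradedSums.coeff_single_same]; exact hm
  · rw [GradedSums.coeff_single_of_ne w h]; exact zero_mem _

/-- The class in degree `k` of `gr^U M` of an element `m` of `U_k M`. -/
noncomputable def symbol {k : ℝ} {m : M} (hm : m ∈ F.U k) : F.Gr :=
  (F.reesLT.submoduleOf F.rees).mkQ ⟨GradedSums.single w M k m, F.single_mem_rees hm⟩

theorem symbol_eq_zero_iff {k : ℝ} {m : M} (hm : m ∈ F.U k) :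
    F.symbol hm = 0 ↔ m ∈ F.lt k := by
  refine (Submodule.Quotient.mk_eq_zero _).trans ?_
  constructor
  · intro h
    have h' : GradedSums.coeff w k (GradedSums.single w M k m) ∈ F.lt k := h k
    rwa [GradedSums.coeff_single_same] at h'
  · intro h l
    by_cases hl : l = k
    · subst hl
      change GradedSums.coeff w l (GradedSums.single w M l m) ∈ _
      rw [GradedSums.coeff_single_same]; exact h
    · change GradedSums.coeff w l (GradedSums.single w M k m) ∈ _
      rw [GradedSums.coeff_single_of_ne w hl]; exact zero_mem _

end gr

end VFiltration

/-! ## Restriction to the hyperplane `x_{n+1} = 0` -/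

section restriction

variable (n : ℕ) (M : Type*) [AddCommGroup M] [Module ℂ M] [Module (Weyl (n + 1)) M]
  [IsScalarTower ℂ (Weyl (n + 1)) M]

/-- A `D_{n+1}`-module, regarded as a `D_n`-module through the inclusion `D_n → D_{n+1}`. -/
def ScalarRestriction (_n : ℕ) (M : Type*) : Type _ := M

noncomputable instance : AddCommGroup (ScalarRestriction n M) := inferInstanceAs (AddCommGroup M)

noncomputable instance : Module ℂ (ScalarRestriction n M) := inferInstanceAs (Module ℂ M)

noncomputable instance : Module (Weyl n) (ScalarRestriction n M) :=
  Module.compHom M (Weyl.incl n).toRingHom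

instance : IsScalarTower ℂ (Weyl n) (ScalarRestriction n M) where
  smul_assoc c P m := by
    change Weyl.incl n (c • P) • (show M from m) = c • (Weyl.incl n P • (show M from m))
    rw [map_smul, smul_assoc]

/-- The `D_n`-submodule `x_{n+1} M` of `M`. -/
noncomputable def xLastMul : Submodule (Weyl n) (ScalarRestriction n M) where
  carrier := {m | ∃ m' : M, m = (Weyl.x (Fin.last n) : Weyl (n + 1)) • m'}
  add_mem' := by
    rintro _ _ ⟨a, rfl⟩ ⟨b, rfl⟩
    exact ⟨a + b, (smul_add _ a b).symm⟩
  zero_mem' := ⟨0, (smul_zero (A := M) (Weyl.x (Fin.last n) : Weyl (n + 1))).symm⟩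
  smul_mem' := by
    rintro P _ ⟨a, rfl⟩
    refine ⟨Weyl.incl n P • a, ?_⟩
    change Weyl.incl n P • (Weyl.x (Fin.last n) • a) = _
    rw [smul_smul, smul_smul, Weyl.incl_mul_x_last]

/-- The restriction `i^* M = M / x_{n+1} M` of the `D_{n+1}`-module `M` along
`i : ℂ^n → ℂ^{n+1}`, `(x_1, …, x_n) ↦ (x_1, …, x_n, 0)`. -/
def Restriction : Type _ := ScalarRestriction n M ⧸ xLastMul n M

noncomputable instance : AddCommGroup (Restriction n M) :=
  inferInstanceAs (AddCommGroup (ScalarRestriction n M ⧸ xLastMul n M))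

noncomputable instance : Module (Weyl n) (Restriction n M) :=
  inferInstanceAs (Module (Weyl n) (ScalarRestriction n M ⧸ xLastMul n M))

noncomputable instance : Module ℂ (Restriction n M) :=
  inferInstanceAs (Module ℂ (ScalarRestriction n M ⧸ xLastMul n M))

instance : IsScalarTower ℂ (Weyl n) (Restriction n M) :=
  inferInstanceAs (IsScalarTower ℂ (Weyl n) (ScalarRestriction n M ⧸ xLastMul n M))

/-- The quotient map `M → i^* M`. -/
noncomputable def Restriction.mk : M →ₗ[ℂ] Restriction n M :=
  (xLastMul n M).mkQ.restrictScalars ℂ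

theorem Restriction.incl_smul_mk (P : Weyl n) (m : M) :
    P • Restriction.mk n M m = Restriction.mk n M (Weyl.incl n P • m) := rfl

end restriction

/-- The filtration of `i^* M` induced by a filtration of `M`: `U_k (i^* M)` is the image of `U_k M`,
that is `U_k M / (x_{n+1} M ∩ U_k M)`. Its weight is `(w_1, …, w_n)`. -/
noncomputable def VFiltration.restrict {n : ℕ} {w : Fin (n + 1) → ℝ} {M : Type*} [AddCommGroup M]
    [Module ℂ M] [Module (Weyl (n + 1)) M] [IsScalarTower ℂ (Weyl (n + 1)) M]
    (F : VFiltration w M) :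
    VFiltration (fun i : Fin n => w i.castSucc) (Restriction n M) where
  U k := (F.U k).map (Restriction.mk n M)
  mono _ _ h := Submodule.map_mono (F.mono h)
  smul_mem := by
    rintro k l P _ hP ⟨m, hm, rfl⟩
    rw [Restriction.incl_smul_mk]
    exact Submodule.mem_map_of_mem (F.smul_mem (Weyl.incl_mem_V w hP) hm)

/-!
Write `t` for the last coordinate, of weight `w_t = max w_i`. In degree `k` the natural map
`i^* gr^U M → gr^U (i^* M)` is the projection
`U_k M / (U_{<k} M + t U_{k + w_t} M) → U_k M / (U_{<k} M + (t M ∩ U_k M))`, so the theorem says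
that an element `t m` of `U_k M` lies in `U_{<k} M + t U_{k + w_t} M`
(`VFiltration.exists_x_last_smul_sub_mem_lt`). No discreteness of the filtration is available,
since the weights may be rationally independent, and `m` need not lie in any `U_l M`. Both
difficulties disappear because of a relation satisfied by every `u ∈ M`
(`NonCharacteristicNearOrigin.exists_relation`):
`(c + h) u = Q t u`, where `c ≠ 0` is a constant, `h ∈ V_{<0} D` commutes with `t`, and
`Q ∈ V_{w_t} D`. Multiplying the relation for `u = m` by `t` gives
`c t m = t (Q t m) - h (t m)`, where `Q t m ∈ U_{k + w_t} M` and `h t m ∈ U_{<k} M`.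

The relation is obtained as follows. As the covector `dt` at the origin is not characteristic,
there is an operator `L` of some order `d`, with symbol `q` not vanishing at `(0, dt)`, which maps
`F_p M` to `F_{p + d - 1} M` for a good filtration `F` with respect to the order filtration of
`D`. By an Artin–Rees argument, which uses that `ℂ[x, ξ]` is noetherian
(`Weyl.exists_shift_mem_orderSpan`), the filtration induced by `F` on `D u` differs from
`(F_p D) u` by a bounded shift, so that `L^r u = S u` for large `r`, with `S` of order less than
`r d`. Hence `P = L^r - S` annihilates `u`, has order `e = r d` and symbol `q^r`. Since
`t^e ∂_t^b` is a left multiple of `t` for `b < e`, and is congruent to `(-1)^e e!` modulo left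
multiples of `t` for `b = e`, the only terms of `t^e P` that are not left multiples of `t` come from
the terms `x^α ∂_t^e` of `P`. Those with `α ≠ 0` give `h`, and the one with `α = 0` gives
`c = (-1)^e e! q(0, dt)^r`. Finally `t^e P ∈ V_0 D` because `P` has order `e` and `w_i ≤ w_t`.
-/

/-! ### Monomials in the Weyl algebra -/

namespace Weyl

/-- A relation between degrees and elements which is compatible with products holds for ordered
monomials if it holds for the generators. -/
theorem prod_ofFn_pow_rel {ι A : Type*} [AddCommMonoid ι] [Monoid A] (R : ι → A → Prop)
    (h1 : R 0 1) (hmul : ∀ {d e a b}, R d a → R e b → R (d + e) (a * b)) {n : ℕ}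
    {e : Fin n → ι} {f : Fin n → A} (hf : ∀ i, R (e i) (f i)) (α : Fin n → ℕ) :
    R (∑ i, α i • e i) (List.ofFn fun i => f i ^ α i).prod := by
  have hpow : ∀ i k, R (k • e i) (f i ^ k) := by
    intro i k
    induction k with
    | zero => simpa using h1
    | succ k ih => rw [succ_nsmul, pow_succ]; exact hmul ih (hf i)
  induction n with
  | zero => simpa using h1
  | succ n ih =>
    rw [Fin.sum_univ_succ, List.ofFn_succ, List.prod_cons]
    exact hmul (hpow 0 _) (ih (fun i => hf i.succ) (fun i => α i.succ) fun i => hpow i.succ)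

theorem prod_ofFn_mul {A : Type*} [Monoid A] {n : ℕ} {f g : Fin n → A}
    (h : ∀ i j, Commute (f i) (g j)) :
    (List.ofFn fun i => f i * g i).prod = (List.ofFn f).prod * (List.ofFn g).prod := by
  induction n with
  | zero => simp
  | succ n ih =>
    simp only [List.ofFn_succ, List.prod_cons]
    rw [ih fun i j => h i.succ j.succ]
    have : Commute (List.ofFn fun i : Fin n => f i.succ).prod (g 0) := by
      refine Commute.list_prod_left _ _ fun a ha => ?_
      obtain ⟨i, rfl⟩ := List.mem_ofFn.1 ha
      exact h _ _
    rw [mul_assoc, mul_assoc, ← mul_assoc (g 0), ← mul_assoc _ (g 0), this.eq]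

variable {n : ℕ}

theorem xPow_add (α γ : Fin n → ℕ) : (xPow (α + γ) : Weyl n) = xPow α * xPow γ := by
  simp only [xPow, Pi.add_apply, pow_add]
  exact prod_ofFn_mul fun i j => (show Commute (x i) (x j) from x_comm i j).pow_pow _ _

theorem dPow_add (α γ : Fin n → ℕ) : (dPow (α + γ) : Weyl n) = dPow α * dPow γ := by
  simp only [dPow, Pi.add_apply, pow_add]
  exact prod_ofFn_mul fun i j => (show Commute (d i) (d j) from d_comm i j).pow_pow _ _

theorem xPow_single (i : Fin n) (k : ℕ) : (xPow (Pi.single i k) : Weyl n) = x i ^ k := by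
  rw [xPow, prod_ofFn_eq_single _ i] <;> simp +contextual

theorem dPow_single (i : Fin n) (k : ℕ) : (dPow (Pi.single i k) : Weyl n) = d i ^ k := by
  rw [dPow, prod_ofFn_eq_single _ i] <;> simp +contextual

@[simp] theorem xPow_zero : (xPow 0 : Weyl n) = 1 := by simp [xPow]

@[simp] theorem dPow_zero : (dPow 0 : Weyl n) = 1 := by simp [dPow]

theorem x_mul_xPow (i : Fin n) (α : Fin n → ℕ) :
    x i * xPow α = (xPow (Pi.single i 1 + α) : Weyl n) := by
  rw [xPow_add, xPow_single, pow_one]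

theorem d_mul_dPow (i : Fin n) (β : Fin n → ℕ) :
    d i * dPow β = (dPow (Pi.single i 1 + β) : Weyl n) := by
  rw [dPow_add, dPow_single, pow_one]

theorem commute_x_xPow (i : Fin n) (α : Fin n → ℕ) : Commute (x i) (xPow α : Weyl n) := by
  refine Commute.list_prod_right _ _ fun a ha => ?_
  obtain ⟨j, rfl⟩ := List.mem_ofFn.1 ha
  exact (show Commute (x i) (x j) from x_comm i j).pow_right _

theorem commute_d_xPow {i : Fin n} {α : Fin n → ℕ} (h : α i = 0) :
    Commute (d i) (xPow α : Weyl n) := by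
  refine Commute.list_prod_right _ _ fun a ha => ?_
  obtain ⟨j, rfl⟩ := List.mem_ofFn.1 ha
  by_cases hj : i = j
  · subst hj; simp [h]
  · refine Commute.pow_right ?_ _
    rw [Commute, SemiconjBy, d_mul_x, if_neg hj, add_zero]

theorem commute_x_dPow {i : Fin n} {β : Fin n → ℕ} (h : β i = 0) :
    Commute (x i) (dPow β : Weyl n) := by
  refine Commute.list_prod_right _ _ fun a ha => ?_
  obtain ⟨j, rfl⟩ := List.mem_ofFn.1 ha
  by_cases hj : j = i
  · subst hj; simp [h]
  · refine Commute.pow_right ?_ _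
    rw [Commute, SemiconjBy, d_mul_x, if_neg hj, add_zero]

theorem d_mul_x_pow (i : Fin n) (k : ℕ) :
    (d i * x i ^ k : Weyl n) = x i ^ k * d i + k • x i ^ (k - 1) := by
  induction k with
  | zero => simp
  | succ k ih =>
    rw [pow_succ', ← mul_assoc, d_mul_x, if_pos rfl, add_mul, mul_assoc, ih, mul_add,
      mul_smul_comm, one_mul, add_tsub_cancel_right, succ_nsmul, mul_assoc, add_assoc]
    congr 2
    cases k with
    | zero => simp
    | succ k => rw [add_tsub_cancel_right, pow_succ']

theorem x_mul_d_pow (i : Fin n) (k : ℕ) :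
    (x i * d i ^ k : Weyl n) = d i ^ k * x i - k • d i ^ (k - 1) := by
  induction k with
  | zero => simp
  | succ k ih =>
    have h : (x i * d i : Weyl n) = d i * x i - 1 := by rw [d_mul_x, if_pos rfl]; abel
    rw [pow_succ', ← mul_assoc, h, sub_mul, mul_assoc, ih, mul_sub,
      mul_smul_comm, one_mul, add_tsub_cancel_right, succ_nsmul, mul_assoc, sub_sub]
    congr 2
    cases k with
    | zero => simp
    | succ k => rw [add_tsub_cancel_right, pow_succ']

theorem d_mul_xPow (i : Fin n) (α : Fin n → ℕ) :
    (d i * xPow α : Weyl n) = xPow α * d i + α i • xPow (α - Pi.single i 1) := by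
  have h : α = Pi.single i (α i) + Function.update α i 0 := by
    ext j
    by_cases hj : j = i
    · subst hj; simp
    · simp [hj]
  have h' : α - Pi.single i 1 = Pi.single i (α i - 1) + Function.update α i 0 := by
    ext j
    by_cases hj : j = i
    · subst hj; simp
    · simp [hj]
  have hc : Commute (d i) (xPow (Function.update α i 0) : Weyl n) := commute_d_xPow (by simp)
  have hα : (xPow α : Weyl n) = x i ^ α i * xPow (Function.update α i 0) := by
    conv_lhs => rw [h]
    rw [xPow_add, xPow_single]
  rw [h', xPow_add, xPow_single, hα, ← mul_assoc, d_mul_x_pow, add_mul, mul_assoc, hc.eq,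
    mul_assoc, smul_mul_assoc]

theorem d_mul_monomial (i : Fin n) (α β : Fin n → ℕ) :
    (d i * (xPow α * dPow β) : Weyl n) =
      xPow α * dPow (Pi.single i 1 + β) + α i • (xPow (α - Pi.single i 1) * dPow β) := by
  rw [← mul_assoc, d_mul_xPow, add_mul, mul_assoc, d_mul_dPow, smul_mul_assoc]

/-! ### The order filtration and the `V`-filtration are multiplicative -/

theorem orderFiltration_mono {p q : ℤ} (h : p ≤ q) : orderFiltration n p ≤ orderFiltration n q := by
  refine Submodule.span_mono ?_
  rintro _ ⟨α, β, hβ, rfl⟩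
  exact ⟨α, β, hβ.trans h, rfl⟩

theorem monomial_mem_orderFiltration {p : ℤ} {α β : Fin n → ℕ} (h : ∑ i, (β i : ℤ) ≤ p) :
    xPow α * dPow β ∈ orderFiltration n p :=
  Submodule.subset_span ⟨α, β, h, rfl⟩

theorem orderFiltration_of_neg {p : ℤ} (hp : p < 0) : orderFiltration n p = ⊥ := by
  refine Submodule.span_eq_bot.2 ?_
  rintro _ ⟨α, β, h, rfl⟩
  have : 0 ≤ ∑ i, (β i : ℤ) := Finset.sum_nonneg fun i _ => by positivity
  omega

theorem x_mul_mem_orderFiltration (i : Fin n) {p : ℤ} {P : Weyl n} (hP : P ∈ orderFiltration n p) :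
    x i * P ∈ orderFiltration n p := by
  have h : orderFiltration n p ≤ (orderFiltration n p).comap (LinearMap.mulLeft ℂ (x i)) := by
    refine Submodule.span_le.2 ?_
    rintro _ ⟨α, β, h, rfl⟩
    change x i * (xPow α * dPow β) ∈ orderFiltration n p
    rw [← mul_assoc, x_mul_xPow]
    exact monomial_mem_orderFiltration h
  exact h hP

theorem d_mul_mem_orderFiltration (i : Fin n) {p : ℤ} {P : Weyl n} (hP : P ∈ orderFiltration n p) :
    d i * P ∈ orderFiltration n (p + 1) := by
  have h : orderFiltration n p ≤ (orderFiltration n (p + 1)).comap (LinearMap.mulLeft ℂ (d i)) := by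
    refine Submodule.span_le.2 ?_
    rintro _ ⟨α, β, h, rfl⟩
    change d i * (xPow α * dPow β) ∈ orderFiltration n (p + 1)
    rw [d_mul_monomial]
    refine add_mem (monomial_mem_orderFiltration ?_)
      (nsmul_mem (monomial_mem_orderFiltration (by omega)) _)
    have : ∑ j, ((Pi.single i 1 : Fin n → ℕ) j : ℤ) = 1 := by
      rw [Finset.sum_eq_single i] <;> simp +contextual
    simp only [Pi.add_apply, Nat.cast_add, Finset.sum_add_distrib]
    omega
  exact h hP

theorem exists_mem_orderFiltration (P : Weyl n) : ∃ p, P ∈ orderFiltration n p := by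
  have h : ∀ k : ℤ, ∃ l, ∀ T ∈ orderFiltration n k, P * T ∈ orderFiltration n l := by
    refine induction (p := fun P => ∀ k : ℤ, ∃ l, ∀ T ∈ orderFiltration n k,
      P * T ∈ orderFiltration n l) ?_ ?_ ?_ ?_ ?_ P
    · intro c k
      refine ⟨k, fun T hT => ?_⟩
      rw [← Algebra.smul_def]
      exact Submodule.smul_mem _ _ hT
    · exact fun i k => ⟨k, fun T hT => x_mul_mem_orderFiltration i hT⟩
    · exact fun i k => ⟨k + 1, fun T hT => d_mul_mem_orderFiltration i hT⟩
    · intro a b ha hb k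
      obtain ⟨l, hl⟩ := ha k
      obtain ⟨l', hl'⟩ := hb k
      refine ⟨max l l', fun T hT => ?_⟩
      rw [add_mul]
      exact add_mem (orderFiltration_mono (le_max_left _ _) (hl T hT))
        (orderFiltration_mono (le_max_right _ _) (hl' T hT))
    · intro a b ha hb k
      obtain ⟨l, hl⟩ := hb k
      obtain ⟨l', hl'⟩ := ha l
      refine ⟨l', fun T hT => ?_⟩
      rw [mul_assoc]
      exact hl' _ (hl T hT)
  obtain ⟨l, hl⟩ := h 0
  refine ⟨l, ?_⟩
  have h1 : (1 : Weyl n) ∈ orderFiltration n 0 := by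
    simpa using monomial_mem_orderFiltration (p := 0) (α := (0 : Fin n → ℕ)) (β := 0) (by simp)
  simpa using hl 1 h1

theorem V_mono (w : Fin n → ℝ) {k l : ℝ} (h : k ≤ l) : V w k ≤ V w l := by
  refine Submodule.span_mono ?_
  rintro _ ⟨α, β, hβ, rfl⟩
  exact ⟨α, β, hβ.trans h, rfl⟩

theorem monomial_mem_V {w : Fin n → ℝ} {k : ℝ} {α β : Fin n → ℕ}
    (h : ∑ i, w i * ((β i : ℝ) - (α i : ℝ)) ≤ k) : xPow α * dPow β ∈ V w k :=
  Submodule.subset_span ⟨α, β, h, rfl⟩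

theorem sum_mul_single (w : Fin n → ℝ) (i : Fin n) :
    ∑ j, w j * ((Pi.single i 1 : Fin n → ℕ) j : ℝ) = w i := by
  rw [Finset.sum_eq_single i] <;> simp +contextual

theorem x_mul_mem_V {w : Fin n → ℝ} (i : Fin n) {k : ℝ} {P : Weyl n} (hP : P ∈ V w k) :
    x i * P ∈ V w (k - w i) := by
  have h : V w k ≤ (V w (k - w i)).comap (LinearMap.mulLeft ℂ (x i)) := by
    refine Submodule.span_le.2 ?_
    rintro _ ⟨α, β, h, rfl⟩
    change x i * (xPow α * dPow β) ∈ V w (k - w i)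
    rw [← mul_assoc, x_mul_xPow]
    refine monomial_mem_V ?_
    have := sum_mul_single w i
    simp only [mul_sub, Pi.add_apply, Nat.cast_add, mul_add, Finset.sum_add_distrib,
      Finset.sum_sub_distrib] at h ⊢
    linarith
  exact h hP

theorem d_mul_mem_V {w : Fin n → ℝ} (i : Fin n) {k : ℝ} {P : Weyl n} (hP : P ∈ V w k) :
    d i * P ∈ V w (k + w i) := by
  have h : V w k ≤ (V w (k + w i)).comap (LinearMap.mulLeft ℂ (d i)) := by
    refine Submodule.span_le.2 ?_
    rintro _ ⟨α, β, h, rfl⟩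
    change d i * (xPow α * dPow β) ∈ V w (k + w i)
    have hi := sum_mul_single w i
    rw [d_mul_monomial]
    refine add_mem (monomial_mem_V ?_) ?_
    · simp only [mul_sub, Pi.add_apply, Nat.cast_add, mul_add, Finset.sum_add_distrib,
        Finset.sum_sub_distrib] at h ⊢
      linarith
    · rcases Nat.eq_zero_or_pos (α i) with h0 | h0
      · rw [h0, zero_smul]; exact zero_mem _
      · refine nsmul_mem (monomial_mem_V ?_) _
        have : α = Pi.single i 1 + (α - Pi.single i 1) := by
          ext j
          by_cases hj : j = i
          · subst hj; simp; omega
          · simp [hj]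
        rw [this] at h
        simp only [mul_sub, Pi.add_apply, Nat.cast_add, mul_add, Finset.sum_add_distrib,
          Finset.sum_sub_distrib] at h ⊢
        linarith
  exact h hP

theorem mul_mem_V {w : Fin n → ℝ} {k l : ℝ} {P Q : Weyl n} (hP : P ∈ V w k) (hQ : Q ∈ V w l) :
    P * Q ∈ V w (k + l) := by
  have h : V w k ≤ (V w (k + l)).comap (LinearMap.mulRight ℂ Q) := by
    refine Submodule.span_le.2 ?_
    rintro _ ⟨α, β, h, rfl⟩
    change xPow α * dPow β * Q ∈ V w (k + l)
    let R : ℝ → Weyl n → Prop := fun c T => ∀ l, ∀ S ∈ V w l, T * S ∈ V w (c + l)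
    have h1 : R 0 1 := fun l S hS => by rwa [one_mul, zero_add]
    have hmul : ∀ {d e a b}, R d a → R e b → R (d + e) (a * b) := fun ha hb l S hS => by
      rw [mul_assoc, add_assoc]; exact ha _ _ (hb _ _ hS)
    have hx : R _ (xPow α) := prod_ofFn_pow_rel R h1 hmul (e := fun i => -w i)
      (fun i l S hS => by rw [neg_add_eq_sub]; exact x_mul_mem_V i hS) α
    have hd : R _ (dPow β) := prod_ofFn_pow_rel R h1 hmul (e := w)
      (fun i l S hS => by rw [add_comm]; exact d_mul_mem_V i hS) β
    refine V_mono w ?_ (hmul hx hd l Q hQ)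
    simp only [nsmul_eq_mul, mul_neg, Finset.sum_neg_distrib, mul_sub,
      Finset.sum_sub_distrib] at h ⊢
    simp only [mul_comm (w _)] at h
    linarith
  exact h hP

end Weyl

namespace Weyl

variable {n : ℕ}

/-! ### Symbols with respect to the order filtration -/

/-- The normal ordering of the part of degree `p` in `ξ` of a polynomial in `ℂ[x, ξ]`. -/
noncomputable def normalOrderPart (n : ℕ) (p : ℤ) :
    MvPolynomial (Fin n ⊕ Fin n) ℂ →ₗ[ℂ] Weyl n :=
  (MvPolynomial.basisMonomials (Fin n ⊕ Fin n) ℂ).constr ℂ fun s =>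
    if ∑ i, (s (Sum.inr i) : ℤ) = p then
      xPow (fun i => s (Sum.inl i)) * dPow (fun i => s (Sum.inr i)) else 0

theorem normalOrderPart_monomial (p : ℤ) (s : Fin n ⊕ Fin n →₀ ℕ) :
    normalOrderPart n p (MvPolynomial.monomial s 1) =
      if ∑ i, (s (Sum.inr i) : ℤ) = p then
        xPow (fun i => s (Sum.inl i)) * dPow (fun i => s (Sum.inr i)) else 0 := by
  rw [← congrFun (MvPolynomial.coe_basisMonomials _ _) s, normalOrderPart,
    Module.Basis.constr_basis]

theorem normalOrder_monomial (s : Fin n ⊕ Fin n →₀ ℕ) :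
    normalOrder n (MvPolynomial.monomial s 1) =
      xPow (fun i => s (Sum.inl i)) * dPow (fun i => s (Sum.inr i)) := by
  rw [← congrFun (MvPolynomial.coe_basisMonomials _ _) s, normalOrder, Module.Basis.constr_basis]

theorem _root_.MvPolynomial.linearMap_mem_of_monomial {σ R N : Type*} [CommSemiring R]
    [AddCommMonoid N] [Module R N] (f : MvPolynomial σ R →ₗ[R] N) (S : Submodule R N)
    (h : ∀ s, f (MvPolynomial.monomial s 1) ∈ S) (b : MvPolynomial σ R) : f b ∈ S := by
  rw [b.as_sum, map_sum]
  refine sum_mem fun s _ => ?_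
  rw [← mul_one (b.coeff s), ← smul_eq_mul, ← MvPolynomial.smul_monomial, map_smul]
  exact S.smul_mem _ (h s)

theorem _root_.MvPolynomial.sub_mem_of_monomial {σ R N : Type*} [CommSemiring R] [AddCommGroup N]
    [Module R N] (f g : MvPolynomial σ R →ₗ[R] N) (S : Submodule R N)
    (h : ∀ s, f (MvPolynomial.monomial s 1) - g (MvPolynomial.monomial s 1) ∈ S)
    (b : MvPolynomial σ R) : f b - g b ∈ S :=
  MvPolynomial.linearMap_mem_of_monomial (f - g) S h b

/-- The second component of `z` is an operator of order at most `d`, and the first component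
represents its principal symbol: multiplication by it in `ℂ[x, ξ] = gr^F D_n` is induced by left
multiplication by the operator. -/
def HasSymbol (d : ℤ) (z : MvPolynomial (Fin n ⊕ Fin n) ℂ × Weyl n) : Prop :=
  (∀ k, ∀ T ∈ orderFiltration n k, z.2 * T ∈ orderFiltration n (k + d)) ∧
    ∀ p b, normalOrderPart n (p + d) (z.1 * b) - z.2 * normalOrderPart n p b ∈
      orderFiltration n (p + d - 1)

theorem hasSymbol_one : HasSymbol (n := n) 0 1 := by
  refine ⟨fun k T hT => by simpa using hT, fun p b => ?_⟩
  simp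

theorem HasSymbol.mul {d e : ℤ} {y z : MvPolynomial (Fin n ⊕ Fin n) ℂ × Weyl n}
    (hy : HasSymbol d y) (hz : HasSymbol e z) : HasSymbol (d + e) (y * z) := by
  refine ⟨fun k T hT => ?_, fun p b => ?_⟩
  · rw [Prod.snd_mul, mul_assoc, add_comm d, ← add_assoc]
    exact hy.1 _ _ (hz.1 _ _ hT)
  · have h1 := hy.2 (p + e) (z.1 * b)
    have h2 := hy.1 _ _ (hz.2 p b)
    rw [show p + e + d - 1 = p + (d + e) - 1 by ring] at h1
    rw [show p + e - 1 + d = p + (d + e) - 1 by ring] at h2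
    have h3 := add_mem h1 h2
    rw [show p + e + d = p + (d + e) by ring, mul_sub, sub_add_sub_cancel] at h3
    rwa [Prod.fst_mul, Prod.snd_mul, mul_assoc, mul_assoc]

theorem HasSymbol.pow {d : ℤ} {y : MvPolynomial (Fin n ⊕ Fin n) ℂ × Weyl n}
    (hy : HasSymbol d y) (r : ℕ) : HasSymbol (r * d) (y ^ r) := by
  induction r with
  | zero => simpa using hasSymbol_one
  | succ r ih =>
    rw [pow_succ, Nat.cast_succ, add_mul, one_mul]
    exact ih.mul hy

theorem hasSymbol_x (i : Fin n) : HasSymbol 0 (MvPolynomial.X (Sum.inl i), x i) := by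
  refine ⟨fun k T hT => by rw [add_zero]; exact x_mul_mem_orderFiltration i hT, fun p b => ?_⟩
  refine MvPolynomial.sub_mem_of_monomial
    (normalOrderPart n (p + 0) ∘ₗ LinearMap.mulLeft ℂ (MvPolynomial.X (Sum.inl i)))
    (LinearMap.mulLeft ℂ (x i) ∘ₗ normalOrderPart n p) (orderFiltration n (p + 0 - 1))
    (fun s => ?_) b
  rw [LinearMap.comp_apply, LinearMap.comp_apply, LinearMap.mulLeft_apply, LinearMap.mulLeft_apply]
  rw [MvPolynomial.X, MvPolynomial.monomial_mul, mul_one, normalOrderPart_monomial,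
    normalOrderPart_monomial]
  have h1 : (fun j => (Finsupp.single (Sum.inl i) 1 + s : Fin n ⊕ Fin n →₀ ℕ) (Sum.inl j)) =
      Pi.single i 1 + fun j => s (Sum.inl j) := by
    ext j
    simp [Finsupp.single_apply, Pi.single_apply, eq_comm]
  rw [h1]
  simp only [Finsupp.add_apply, Finsupp.single_apply, reduceCtorEq, if_false, zero_add, add_zero]
  rw [← x_mul_xPow]
  split_ifs <;> simp [mul_assoc]

theorem hasSymbol_d (i : Fin n) : HasSymbol 1 (MvPolynomial.X (Sum.inr i), d i) := by
  refine ⟨fun k T hT => d_mul_mem_orderFiltration i hT, fun p b => ?_⟩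
  refine MvPolynomial.sub_mem_of_monomial
    (normalOrderPart n (p + 1) ∘ₗ LinearMap.mulLeft ℂ (MvPolynomial.X (Sum.inr i)))
    (LinearMap.mulLeft ℂ (d i) ∘ₗ normalOrderPart n p) (orderFiltration n (p + 1 - 1))
    (fun s => ?_) b
  rw [LinearMap.comp_apply, LinearMap.comp_apply, LinearMap.mulLeft_apply, LinearMap.mulLeft_apply]
  rw [MvPolynomial.X, MvPolynomial.monomial_mul, mul_one, normalOrderPart_monomial,
    normalOrderPart_monomial]
  have h1 : (fun j => (Finsupp.single (Sum.inr i) 1 + s : Fin n ⊕ Fin n →₀ ℕ) (Sum.inr j)) =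
      Pi.single i 1 + fun j => s (Sum.inr j) := by
    ext j
    simp [Finsupp.single_apply, Pi.single_apply, eq_comm]
  have h2 : ∑ j, ((Finsupp.single (Sum.inr i) 1 + s : Fin n ⊕ Fin n →₀ ℕ) (Sum.inr j) : ℤ) =
      1 + ∑ j, (s (Sum.inr j) : ℤ) := by
    simp [Finsupp.single_apply, Finset.sum_add_distrib]
  rw [h1, h2]
  simp only [Finsupp.add_apply, Finsupp.single_apply, reduceCtorEq, if_false, zero_add,
    add_comm p, add_right_inj, add_sub_cancel_left]
  split_ifs with h
  · rw [d_mul_monomial, sub_add_cancel_left]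
    exact neg_mem (nsmul_mem (monomial_mem_orderFiltration h.le) _)
  · simp

theorem hasSymbol_monomial (s : Fin n ⊕ Fin n →₀ ℕ) :
    HasSymbol (∑ i, (s (Sum.inr i) : ℤ)) (MvPolynomial.monomial s 1,
      xPow (fun i => s (Sum.inl i)) * dPow (fun i => s (Sum.inr i))) := by
  have hx := prod_ofFn_pow_rel HasSymbol hasSymbol_one HasSymbol.mul hasSymbol_x
    fun i => s (Sum.inl i)
  have hd := prod_ofFn_pow_rel HasSymbol hasSymbol_one HasSymbol.mul hasSymbol_d
    fun i => s (Sum.inr i)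
  have key : ∀ (f : Fin n → MvPolynomial (Fin n ⊕ Fin n) ℂ) (g : Fin n → Weyl n)
      (α : Fin n → ℕ), (List.ofFn fun i => (f i, g i) ^ α i).prod =
        (∏ i, f i ^ α i, (List.ofFn fun i => g i ^ α i).prod) := by
    intro f g α
    refine Prod.ext ?_ ?_
    · rw [← MonoidHom.coe_fst, map_list_prod, List.map_ofFn, ← List.prod_ofFn]
      rfl
    · rw [← MonoidHom.coe_snd, map_list_prod, List.map_ofFn]
      rfl
  rw [key] at hx hd
  have h := hx.mul hd
  rw [Prod.mk_mul_mk] at h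
  convert h using 3
  · simp
  · rw [MvPolynomial.monomial_eq, Finsupp.prod_fintype _ _ (by simp), Fintype.prod_sum_type]
    simp
  · rfl
  · rfl

theorem HasSymbol.smul_add {d : ℤ} {y z : MvPolynomial (Fin n ⊕ Fin n) ℂ × Weyl n}
    (hy : HasSymbol d y) (hz : HasSymbol d z) (c : ℂ) : HasSymbol d (c • y + z) := by
  refine ⟨fun k T hT => ?_, fun p b => ?_⟩
  · rw [Prod.snd_add, Prod.smul_snd, add_mul, smul_mul_assoc]
    exact add_mem (Submodule.smul_mem _ _ (hy.1 k T hT)) (hz.1 k T hT)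
  · rw [Prod.snd_add, Prod.smul_snd, Prod.fst_add, Prod.smul_fst, add_mul, add_mul,
      smul_mul_assoc, smul_mul_assoc, map_add, map_smul, add_sub_add_comm, ← smul_sub]
    exact add_mem (Submodule.smul_mem _ _ (hy.2 p b)) (hz.2 p b)

theorem hasSymbol_zero (d : ℤ) : HasSymbol (n := n) d 0 :=
  ⟨fun k T _ => by simp, fun p b => by simp⟩

theorem hasSymbol_normalOrder {d : ℕ} {q : MvPolynomial (Fin n ⊕ Fin n) ℂ}
    (hq : MvPolynomial.IsWeightedHomogeneous
      (Sum.elim (fun _ => 0) (fun _ => 1) : Fin n ⊕ Fin n → ℕ) q d) :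
    HasSymbol d (q, normalOrder n q) := by
  have h : ∀ S ⊆ q.support, HasSymbol d
      (∑ s ∈ S, q.coeff s • (MvPolynomial.monomial s (1 : ℂ), normalOrder n
        (MvPolynomial.monomial s 1))) := by
    intro S
    induction S using Finset.induction_on with
    | empty => exact fun _ => hasSymbol_zero _
    | insert s S hs ih =>
      intro hS
      rw [Finset.sum_insert hs]
      refine HasSymbol.smul_add ?_ (ih fun s hs => hS (Finset.mem_insert_of_mem hs)) _
      have hsd := hq (MvPolynomial.mem_support_iff.1 (hS (Finset.mem_insert_self _ _)))
      rw [normalOrder_monomial]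
      convert hasSymbol_monomial s
      rw [← hsd, Finsupp.weight_apply, Finsupp.sum_fintype _ _ (by simp), Fintype.sum_sum_type]
      simp
  have h' := h _ subset_rfl
  have hq' : q = ∑ s ∈ q.support, q.coeff s • MvPolynomial.monomial s (1 : ℂ) := by
    conv_lhs => rw [q.as_sum]
    simp [MvPolynomial.smul_monomial]
  refine (congrArg (HasSymbol (d : ℤ)) (Prod.ext ?_ ?_)).mpr h'
  · rw [Prod.fst_sum]; exact hq'
  · rw [Prod.snd_sum]
    conv_lhs => rw [hq', map_sum]
    simp only [map_smul, Prod.smul_snd]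

/-! ### Artin–Rees -/

section ArtinRees

variable {M : Type*} [AddCommGroup M] [Module ℂ M] [Module (Weyl n) M]
  [IsScalarTower ℂ (Weyl n) M] {s : ℕ} (m : Fin s → M)

/-- The subspace `(F_p D_n) u` of `M`. -/
noncomputable def orderSpan (n : ℕ) {M : Type*} [AddCommGroup M] [Module ℂ M] [Module (Weyl n) M]
    [IsScalarTower ℂ (Weyl n) M] (u : M) (p : ℤ) : Submodule ℂ M :=
  (orderFiltration n p).map ((LinearMap.toSpanSingleton (Weyl n) M u).restrictScalars ℂ)

/-- The good filtration `F_p M = ∑_j (F_p D_n) m_j` generated in degree `0` by `m_1, …, m_s`. -/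
noncomputable def orderFiltrationOf (n : ℕ) {M : Type*} [AddCommGroup M] [Module ℂ M]
    [Module (Weyl n) M] [IsScalarTower ℂ (Weyl n) M] {s : ℕ} (m : Fin s → M) (p : ℤ) :
    Submodule ℂ M :=
  ⨆ j, orderSpan n (m j) p

theorem isGoodFiltration_orderFiltrationOf :
    IsGoodFiltration (orderFiltration n) (orderFiltrationOf n m) :=
  ⟨s, m, 0, fun p => by simp [orderFiltrationOf, orderSpan]⟩

theorem orderSpan_le (j : Fin s) (p : ℤ) :
    orderSpan n (m j) p ≤ orderFiltrationOf n m p :=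
  le_iSup (fun j => orderSpan n (m j) p) j

theorem smul_mem_orderFiltrationOf {p : ℤ} {T : Weyl n} (hT : T ∈ orderFiltration n p)
    (j : Fin s) : T • m j ∈ orderFiltrationOf n m p :=
  orderSpan_le m j p ⟨T, hT, rfl⟩

theorem orderFiltrationOf_of_neg {p : ℤ} (h : p < 0) : orderFiltrationOf n m p = ⊥ := by
  simp [orderFiltrationOf, orderSpan, orderFiltration_of_neg h]

theorem HasSymbol.smul_mem {d : ℤ} {z : MvPolynomial (Fin n ⊕ Fin n) ℂ × Weyl n}
    (hz : HasSymbol d z) {p : ℤ} {y : M} (hy : y ∈ orderFiltrationOf n m p) :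
    z.2 • y ∈ orderFiltrationOf n m (p + d) := by
  have h : orderFiltrationOf n m p ≤
      (orderFiltrationOf n m (p + d)).comap (Algebra.lsmul ℂ ℂ M z.2) := by
    refine iSup_le fun j => ?_
    rintro _ ⟨T, hT, rfl⟩
    change z.2 • T • m j ∈ orderFiltrationOf n m (p + d)
    rw [smul_smul]
    exact smul_mem_orderFiltrationOf m (hz.1 _ _ hT) j
  exact h hy

theorem exists_mem_orderFiltrationOf (hm : Submodule.span (Weyl n) (Set.range m) = ⊤) (y : M) :
    ∃ p, y ∈ orderFiltrationOf n m p := by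
  obtain ⟨c, rfl⟩ := (Submodule.mem_span_range_iff_exists_fun _).1
    (hm ▸ Submodule.mem_top : y ∈ Submodule.span (Weyl n) (Set.range m))
  choose p hp using fun j => exists_mem_orderFiltration (c j)
  obtain ⟨q, hq⟩ := (Set.finite_range p).bddAbove
  exact ⟨q, sum_mem fun j _ => smul_mem_orderFiltrationOf m
    (orderFiltration_mono (hq ⟨j, rfl⟩) (hp j)) j⟩

/-- The map `ℂ[x, ξ]^s → M` sending `a` to `∑_j P_j m_j`, where `P_j` is the normal ordering of the
part of degree `p` of `a_j`; modulo `F_{p-1} M` it is the degree `p` part of the presentation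
of `gr^F M`. -/
noncomputable def presentation (p : ℤ) :
    (Fin s → MvPolynomial (Fin n ⊕ Fin n) ℂ) →ₗ[ℂ] M :=
  ∑ j, ((LinearMap.toSpanSingleton (Weyl n) M (m j)).restrictScalars ℂ) ∘ₗ
    normalOrderPart n p ∘ₗ LinearMap.proj j

theorem presentation_apply (p : ℤ) (a : Fin s → MvPolynomial (Fin n ⊕ Fin n) ℂ) :
    presentation m p a = ∑ j, normalOrderPart n p (a j) • m j := by
  simp [presentation]

theorem HasSymbol.presentation_smul {d : ℤ} {z : MvPolynomial (Fin n ⊕ Fin n) ℂ × Weyl n}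
    (hz : HasSymbol d z) (p : ℤ) (a : Fin s → MvPolynomial (Fin n ⊕ Fin n) ℂ) :
    presentation m (p + d) (z.1 • a) - z.2 • presentation m p a ∈
      orderFiltrationOf n m (p + d - 1) := by
  rw [presentation_apply, presentation_apply, Finset.smul_sum, ← Finset.sum_sub_distrib]
  refine sum_mem fun j _ => ?_
  rw [smul_smul, ← sub_smul]
  exact smul_mem_orderFiltrationOf m (hz.2 p (a j)) j

/-- The `ℂ[x, ξ]`-submodule of those `a` whose image in each degree `p` of `gr^F M` is the class
of an element of `(F_{p+c} D_n) u`. -/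
noncomputable def symbolModule (u : M) (c : ℕ) : Submodule (MvPolynomial (Fin n ⊕ Fin n) ℂ)
    (Fin s → MvPolynomial (Fin n ⊕ Fin n) ℂ) where
  carrier := {a | ∀ p, presentation m p a ∈
    orderSpan n u (p + c) ⊔ orderFiltrationOf n m (p - 1)}
  add_mem' ha hb p := by rw [map_add]; exact add_mem (ha p) (hb p)
  zero_mem' p := by rw [map_zero]; exact zero_mem _
  smul_mem' h a ha p := by
    refine MvPolynomial.linearMap_mem_of_monomial (presentation m p ∘ₗ
      (LinearMap.toSpanSingleton (MvPolynomial (Fin n ⊕ Fin n) ℂ) _ a).restrictScalars ℂ) _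
      (fun t => ?_) h
    have ht := hasSymbol_monomial t
    set d := ∑ i, (t (Sum.inr i) : ℤ)
    have h1 := ht.presentation_smul m (p - d) a
    rw [sub_add_cancel] at h1
    obtain ⟨_, ⟨T, hT, rfl⟩, y, hy, hTy⟩ := Submodule.mem_sup.1 (ha (p - d))
    have h2 := ht.smul_mem m hy
    have h3 := ht.1 _ _ hT
    rw [show p - d - 1 + d = p - 1 by ring] at h2
    rw [show p - d + c + d = p + c by ring] at h3
    rw [← hTy] at h1
    refine Submodule.mem_sup.2 ⟨_, ⟨_, h3, rfl⟩, _, add_mem h1 h2, ?_⟩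
    simp only [LinearMap.coe_restrictScalars, LinearMap.toSpanSingleton_apply,
      LinearMap.comp_apply, mul_smul, smul_add]
    abel

/-- The filtrations `F_p M ∩ D_n u` and `(F_p D_n) u` of the submodule `D_n u` of `M`
differ by a bounded shift. -/
theorem exists_shift_mem_orderSpan (u : M) : ∃ c : ℕ, ∀ (p : ℤ) (T : Weyl n),
    T • u ∈ orderFiltrationOf n m p → T • u ∈ orderSpan n u (p + c) := by
  have hmono : Monotone (symbolModule (n := n) m u) := fun c c' h a ha p =>
    (show orderSpan n u (p + c) ⊔ orderFiltrationOf n m (p - 1) ≤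
        orderSpan n u (p + c') ⊔ orderFiltrationOf n m (p - 1) from
      sup_le_sup (Submodule.map_mono (orderFiltration_mono (by omega))) le_rfl) (ha p)
  obtain ⟨c, hc⟩ := monotone_stabilizes_iff_noetherian.2
    (inferInstance : IsNoetherian (MvPolynomial (Fin n ⊕ Fin n) ℂ)
      (Fin s → MvPolynomial (Fin n ⊕ Fin n) ℂ)) ⟨symbolModule m u, hmono⟩
  refine ⟨c, fun p => ?_⟩
  -- every element of `F_p M` is congruent to the image of a vector of degree `p`
  have hlift : ∀ p, orderFiltrationOf n m p ≤
      (⨅ q ∈ {q | q ≠ p}, LinearMap.ker (presentation (n := n) m q)).map (presentation m p) ⊔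
        orderFiltrationOf n m (p - 1) := by
    intro p
    refine iSup_le fun j => ?_
    rw [orderSpan, Submodule.map_le_iff_le_comap, orderFiltration, Submodule.span_le]
    rintro _ ⟨α, β, h, rfl⟩
    rcases h.lt_or_eq with h | h
    · exact Submodule.mem_sup_right (smul_mem_orderFiltrationOf m
        (monomial_mem_orderFiltration (by omega)) j)
    · refine Submodule.mem_sup_left ⟨Pi.single j (MvPolynomial.monomial
        (Finsupp.equivFunOnFinite.symm (Sum.elim α β)) 1), ?_, ?_⟩
      · simp only [SetLike.mem_coe, Submodule.mem_iInf, LinearMap.mem_ker]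
        intro q hq
        rw [presentation_apply, Finset.sum_eq_single j]
        · rw [Pi.single_eq_same, normalOrderPart_monomial, if_neg, zero_smul]
          simpa [h] using Ne.symm hq
        · intro i _ hi; simp [hi]
        · simp
      · rw [presentation_apply, Finset.sum_eq_single j]
        · rw [Pi.single_eq_same, normalOrderPart_monomial, if_pos (by simpa using h)]
          simp
        · intro i _ hi; simp [hi]
        · simp
  obtain hp | hp := lt_or_ge p 0
  · intro T hT
    rw [orderFiltrationOf_of_neg m hp, Submodule.mem_bot] at hT
    rw [hT]; exact zero_mem _
  refine Int.leInduction (m := -1)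
    (motive := fun p _ => ∀ T : Weyl n, T • u ∈ orderFiltrationOf n m p →
      T • u ∈ orderSpan n u (p + c)) ?_ ?_ p (by omega)
  · intro T hT
    rw [orderFiltrationOf_of_neg m (by norm_num), Submodule.mem_bot] at hT
    rw [hT]; exact zero_mem _
  intro p hp ih T hT
  obtain ⟨_, ⟨a, ha, rfl⟩, y, hy, hay⟩ := Submodule.mem_sup.1 (hlift _ hT)
  simp only [SetLike.mem_coe, Submodule.mem_iInf, LinearMap.mem_ker] at ha
  obtain ⟨e, he⟩ := exists_mem_orderFiltration T
  have hac : a ∈ symbolModule (n := n) m u (max c (e - (p + 1)).toNat) := by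
    intro q
    by_cases hq : q = p + 1
    · subst hq
      rw [← eq_sub_iff_add_eq] at hay
      rw [hay]
      exact sub_mem (Submodule.mem_sup_left ⟨T, orderFiltration_mono (by push_cast; omega) he, rfl⟩)
        (Submodule.mem_sup_right hy)
    · rw [ha q hq]; exact zero_mem _
  have hac' : a ∈ symbolModule (n := n) m u c := by
    have := hc (max c (e - (p + 1)).toNat) (le_max_left _ _)
    change symbolModule (n := n) m u c = symbolModule (n := n) m u _ at this
    rwa [this]
  obtain ⟨_, ⟨S, hS, rfl⟩, y', hy', hay'⟩ := Submodule.mem_sup.1 (hac' (p + 1))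
  rw [← hay'] at hay
  have hTS : (T - S) • u = y' + y := by
    rw [sub_smul, ← hay]
    change S • u + y' + y - S • u = _
    abel
  have h1 := ih (T - S) (by
    rw [hTS]
    rw [add_sub_cancel_right] at hy hy'
    exact add_mem hy' hy)
  have h2 : T • u = (T - S) • u + S • u := by rw [sub_smul, sub_add_cancel]
  rw [h2]
  exact add_mem (Submodule.map_mono (orderFiltration_mono (by omega)) h1) ⟨S, hS, rfl⟩

end ArtinRees

end Weyl

namespace Weyl

/-! ### Operators modulo left multiples of the last coordinate -/

section LastCoordinate

variable {n : ℕ} (w : Fin (n + 1) → ℝ)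

/-- `(V_{w_t} D) t`, where `t` is the last coordinate. -/
noncomputable def vMulLast : Submodule ℂ (Weyl (n + 1)) :=
  (V w (w (Fin.last n))).map (LinearMap.mulRight ℂ (x (Fin.last n)))

/-- The operators in `V_{-δ} D` which commute with the last coordinate `t`. -/
noncomputable def vCommLast (δ : ℝ) : Submodule ℂ (Weyl (n + 1)) :=
  V w (-δ) ⊓ Subalgebra.toSubmodule (Subalgebra.centralizer ℂ {x (Fin.last n)})

/-- Modulo left multiples of `t`, the operator `t^e ∂_t^b` is `(-1)^b b!` if `b = e`, and `0`
if `b < e`. -/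
theorem exists_x_pow_mul_d_pow {b e : ℕ} (h : b ≤ e) :
    ∃ Q ∈ V w (((b : ℝ) - e + 1) * w (Fin.last n)),
    (x (Fin.last n) ^ e * d (Fin.last n) ^ b : Weyl (n + 1)) =
      Q * x (Fin.last n) + algebraMap ℂ _ (if b = e then (-1) ^ b * (b.factorial : ℂ) else 0) := by
  induction e generalizing b with
  | zero =>
    obtain rfl : b = 0 := by omega
    exact ⟨0, zero_mem _, by simp⟩
  | succ e ih =>
    have hxd : (x (Fin.last n) ^ e * d (Fin.last n) ^ b : Weyl (n + 1)) ∈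
        V w (((b : ℝ) - e) * w (Fin.last n)) := by
      rw [← xPow_single, ← dPow_single]
      refine monomial_mem_V (le_of_eq ?_)
      rw [Finset.sum_eq_single (Fin.last n)]
      · simp; ring
      · intro i _ hi; simp [hi]
      · simp
    rw [pow_succ, mul_assoc, x_mul_d_pow, mul_sub, ← mul_assoc]
    cases b with
    | zero => exact ⟨_, V_mono w (by push_cast; apply le_of_eq; ring) hxd, by simp⟩
    | succ b =>
      obtain ⟨Q, hQ, hQe⟩ := ih (b := b) (by omega)
      refine ⟨x (Fin.last n) ^ e * d (Fin.last n) ^ (b + 1) - (b + 1) • Q,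
        sub_mem (V_mono w (by push_cast; apply le_of_eq; ring) hxd)
          (nsmul_mem (V_mono w (by push_cast; apply le_of_eq; ring) hQ) _), ?_⟩
      rw [add_tsub_cancel_right, mul_smul_comm, hQe, smul_add, sub_mul, smul_mul_assoc,
        sub_add_eq_sub_sub, sub_eq_add_neg (_ - _), ← map_nsmul, ← map_neg]
      congr 2
      split_ifs with h1 h2 h2
      · rw [Nat.factorial_succ]; push_cast; simp only [nsmul_eq_mul]; push_cast; ring
      · omega
      · omega
      · simp

theorem dPow_eq_mul_last (β : Fin (n + 1) → ℕ) : (dPow β : Weyl (n + 1)) =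
    dPow (Function.update β (Fin.last n) 0) * d (Fin.last n) ^ β (Fin.last n) := by
  rw [← dPow_single, ← dPow_add]
  congr 1
  ext j
  by_cases hj : j = Fin.last n
  · subst hj; simp
  · simp [hj]

variable {w}

/-- The case of a single monomial of order at most `e`. Its `V`-degree is at most `e w_t` because
`w_t` is the largest weight, so that its product with `t^e` has `V`-degree at most `0`. -/
theorem x_pow_mul_monomial_mem (hw : ∀ i, 0 < w i ∧ w i ≤ w (Fin.last n)) {δ : ℝ}
    (hδ : ∀ i, δ ≤ w i) {e : ℕ} {α β : Fin (n + 1) → ℕ} (h : ∑ i, β i ≤ e) :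
    x (Fin.last n) ^ e * (xPow α * dPow β) - algebraMap ℂ (Weyl (n + 1))
      (if α = 0 ∧ β = Pi.single (Fin.last n) e then (-1) ^ e * (e.factorial : ℂ) else 0) ∈
        vCommLast w δ ⊔ vMulLast w := by
  set t : Weyl (n + 1) := x (Fin.last n) with ht
  set b := β (Fin.last n) with hb
  set β' := Function.update β (Fin.last n) 0 with hβ'
  have hsum : ∑ i, β' i + b = ∑ i, β i := by
    rw [Fin.sum_univ_castSucc, Fin.sum_univ_castSucc]
    simp [β', b, (Fin.castSucc_lt_last _).ne]
  obtain ⟨Q, hQ, hQe⟩ := exists_x_pow_mul_d_pow w (show b ≤ e by omega)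
  have hcomm : t ^ e * (xPow α * dPow β) =
      xPow α * dPow β' * Q * t + xPow α * dPow β' *
        algebraMap ℂ _ (if b = e then (-1) ^ b * (b.factorial : ℂ) else 0) := by
    have h1 : Commute (t ^ e) (xPow α * dPow β') :=
      ((commute_x_xPow _ α).mul_right (commute_x_dPow (by simp [β']))).pow_left e
    rw [dPow_eq_mul_last, ← mul_assoc (xPow α), ← mul_assoc, h1.eq, mul_assoc, hQe, mul_add,
      ← mul_assoc]
  have hmem : xPow α * dPow β' * Q * t ∈ vMulLast w := by
    refine ⟨xPow α * dPow β' * Q, V_mono w ?_ (mul_mem_V (monomial_mem_V le_rfl) hQ), rfl⟩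
    have h1 : ∑ i, w i * ((β' i : ℝ) - α i) ≤ ∑ i, w (Fin.last n) * (β' i : ℝ) := by
      refine Finset.sum_le_sum fun i _ => ?_
      have h2 : (0 : ℝ) ≤ β' i := by positivity
      have h3 : (0 : ℝ) ≤ α i := by positivity
      nlinarith [mul_nonneg (hw i).1.le h3, mul_le_mul_of_nonneg_right (hw i).2 h2]
    rw [← Finset.mul_sum] at h1
    have h4 : (∑ i, (β' i : ℝ)) + b ≤ e := by exact_mod_cast (hsum.trans_le h)
    nlinarith [(hw (Fin.last n)).1]
  rw [hcomm, add_sub_assoc]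
  refine Submodule.add_mem _ (Submodule.mem_sup_right hmem) (Submodule.mem_sup_left ?_)
  by_cases hbe : b = e
  · have hβ'0 : β' = 0 := by
      have h0 : ∑ i, β' i = 0 := by omega
      ext i
      exact Finset.sum_eq_zero_iff.1 h0 i (Finset.mem_univ i)
    have hβ : β = Pi.single (Fin.last n) e := by
      ext j
      by_cases hj : j = Fin.last n
      · subst hj; simpa using hbe
      · have := congrFun hβ'0 j
        simpa [β', hj] using this
    rw [if_pos hbe, hβ'0, dPow_zero, mul_one, hbe]
    by_cases hα : α = 0
    · rw [if_pos ⟨hα, hβ⟩, hα, xPow_zero, one_mul, sub_self]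
      exact zero_mem _
    · rw [if_neg fun hh => hα hh.1, map_zero, sub_zero, ← Algebra.commutes, ← Algebra.smul_def]
      refine Submodule.smul_mem _ _ ⟨?_, ?_⟩
      · obtain ⟨i, hi⟩ := Function.ne_iff.1 hα
        have h1 : (1 : ℝ) ≤ α i := by exact_mod_cast Nat.one_le_iff_ne_zero.2 hi
        have h2 : w i * α i ≤ ∑ j, w j * (α j : ℝ) :=
          Finset.single_le_sum (f := fun j => w j * (α j : ℝ))
            (fun j _ => mul_nonneg (hw j).1.le (by positivity)) (Finset.mem_univ i)
        have := monomial_mem_V (w := w) (k := -δ) (α := α) (β := 0) (by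
          simp only [Pi.zero_apply, Nat.cast_zero, zero_sub, mul_neg, Finset.sum_neg_distrib]
          nlinarith [hδ i, (hw i).1])
        simpa using this
      · refine (Subalgebra.mem_centralizer_iff ℂ).2 fun g hg => ?_
        rw [Set.mem_singleton_iff.1 hg]
        exact commute_x_xPow _ α
  · have hβ : ¬ (α = 0 ∧ β = Pi.single (Fin.last n) e) := fun hh => hbe (by rw [hb, hh.2]; simp)
    rw [if_neg hbe, if_neg hβ, map_zero, mul_zero, sub_zero]
    exact zero_mem _

/-- Modulo the left multiples of `t` and operators in `V_{-δ} D`, the operator `t^e P`, where `P`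
has order `e`, is a nonzero multiple of the value at `(0, dt)` of the principal symbol of `P`. -/
theorem x_pow_mul_normalOrderPart_mem (hw : ∀ i, 0 < w i ∧ w i ≤ w (Fin.last n)) {δ : ℝ}
    (hδ : ∀ i, δ ≤ w i) (e : ℕ) (a : MvPolynomial (Fin (n + 1) ⊕ Fin (n + 1)) ℂ) :
    x (Fin.last n) ^ e * normalOrderPart (n + 1) e a - algebraMap ℂ (Weyl (n + 1))
      ((-1) ^ e * (e.factorial : ℂ) * a.coeff (Finsupp.single (Sum.inr (Fin.last n)) e)) ∈
        vCommLast w δ ⊔ vMulLast w := by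
  refine MvPolynomial.sub_mem_of_monomial
    (LinearMap.mulLeft ℂ (x (Fin.last n) ^ e) ∘ₗ normalOrderPart (n + 1) e)
    (Algebra.linearMap ℂ (Weyl (n + 1)) ∘ₗ LinearMap.mulLeft ℂ ((-1) ^ e * (e.factorial : ℂ)) ∘ₗ
      MvPolynomial.lcoeff ℂ (Finsupp.single (Sum.inr (Fin.last n)) e))
    (vCommLast w δ ⊔ vMulLast w) (fun s => ?_) a
  rw [LinearMap.comp_apply, LinearMap.comp_apply, LinearMap.comp_apply, LinearMap.mulLeft_apply,
    LinearMap.mulLeft_apply, Algebra.linearMap_apply, normalOrderPart_monomial,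
    MvPolynomial.lcoeff_apply, MvPolynomial.coeff_monomial]
  have hs : s = Finsupp.single (Sum.inr (Fin.last n)) e ↔
      (fun i => s (Sum.inl i)) = 0 ∧ (fun i => s (Sum.inr i)) = Pi.single (Fin.last n) e := by
    constructor
    · rintro rfl
      constructor
      · ext i; simp
      · ext i; simp [Finsupp.single_apply, Pi.single_apply, eq_comm]
    · rintro ⟨h1, h2⟩
      ext (i | i)
      · simpa using congrFun h1 i
      · rw [congrFun h2 i]; simp [Finsupp.single_apply, Pi.single_apply, eq_comm]
  split_ifs with h1 h2 h2
  · have h3 := x_pow_mul_monomial_mem hw hδ (α := fun i => s (Sum.inl i))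
      (β := fun i => s (Sum.inr i)) (e := e) (by exact_mod_cast h1.le)
    rwa [if_pos (hs.1 h2), ← mul_one ((-1) ^ e * (e.factorial : ℂ))] at h3
  · have h3 := x_pow_mul_monomial_mem hw hδ (α := fun i => s (Sum.inl i))
      (β := fun i => s (Sum.inr i)) (e := e) (by exact_mod_cast h1.le)
    rwa [if_neg (fun h => h2 (hs.2 h)), ← mul_zero ((-1) ^ e * (e.factorial : ℂ))] at h3
  · refine absurd ?_ h1
    rw [h2]
    simp [Finsupp.single_apply]
  · simp

theorem x_pow_mul_mem_of_lt (hw : ∀ i, 0 < w i ∧ w i ≤ w (Fin.last n)) {δ : ℝ}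
    (hδ : ∀ i, δ ≤ w i) {e : ℕ} {p : ℤ} (hp : p < e) {T : Weyl (n + 1)}
    (hT : T ∈ orderFiltration (n + 1) p) :
    x (Fin.last n) ^ e * T ∈ vCommLast w δ ⊔ vMulLast w := by
  have h : orderFiltration (n + 1) p ≤ (vCommLast w δ ⊔ vMulLast w).comap
      (LinearMap.mulLeft ℂ (x (Fin.last n) ^ e)) := by
    refine Submodule.span_le.2 ?_
    rintro _ ⟨α, β, h, rfl⟩
    have h' : ∑ i, β i < e := by exact_mod_cast h.trans_lt hp
    have h3 := x_pow_mul_monomial_mem hw hδ (α := α) h'.le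
    rwa [if_neg, map_zero, sub_zero] at h3
    rintro ⟨-, rfl⟩
    simp at h'
  exact h hT

theorem eval_conormal_eq_coeff {d : ℕ} {q : MvPolynomial (Fin (n + 1) ⊕ Fin (n + 1)) ℂ}
    (hq : MvPolynomial.IsWeightedHomogeneous
      (Sum.elim (fun _ => 0) (fun _ => 1) : Fin (n + 1) ⊕ Fin (n + 1) → ℕ) q d) :
    MvPolynomial.eval (Sum.elim 0 (Pi.single (Fin.last n) 1)) q =
      q.coeff (Finsupp.single (Sum.inr (Fin.last n)) d) := by
  rw [MvPolynomial.eval_eq']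
  rw [Finset.sum_eq_single (Finsupp.single (Sum.inr (Fin.last n)) d)]
  · rw [Finset.prod_eq_one, mul_one]
    rintro (i | i) _
    · simp
    · by_cases hi : i = Fin.last n
      · subst hi; simp
      · simp [Ne.symm hi]
  · intro s hs hne
    rw [Fintype.prod_sum_type, Fin.prod_univ_castSucc (f := fun i => (Sum.elim (0 : Fin (n + 1) → ℂ)
      (Pi.single (Fin.last n) 1) (Sum.inr i)) ^ s (Sum.inr i))]
    by_contra h0
    have h1 := right_ne_zero_of_mul h0
    have h2 := left_ne_zero_of_mul h1
    have h3 := left_ne_zero_of_mul (right_ne_zero_of_mul h1)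
    rw [Finset.prod_ne_zero_iff] at h2 h3
    have hsd := hq (MvPolynomial.mem_support_iff.1 hs)
    rw [Finsupp.weight_apply, Finsupp.sum_fintype _ _ (by simp), Fintype.sum_sum_type,
      Fin.sum_univ_castSucc (f := fun i => s (Sum.inr i) • _)] at hsd
    have h2' : ∀ i, s (Sum.inl i) = 0 := fun i => by
      by_contra hi; exact h2 i (Finset.mem_univ _) (by simp [hi])
    have h3' : ∀ i : Fin n, s (Sum.inr i.castSucc) = 0 := fun i => by
      by_contra hi
      exact h3 i (Finset.mem_univ _) (by simp [hi, (Fin.castSucc_lt_last i).ne])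
    simp only [Sum.elim_inl, Sum.elim_inr, h3', smul_eq_mul, mul_zero, mul_one,
      Finset.sum_const_zero, zero_add] at hsd
    refine hne (Finsupp.ext ?_)
    rintro (i | i)
    · simp [h2']
    · refine Fin.lastCases ?_ (fun i => ?_) i
      · simp [hsd]
      · simp [h3']
  · intro h
    rw [MvPolynomial.notMem_support_iff.1 h, zero_mul]

end LastCoordinate

end Weyl

/-! ### The relation satisfied by elements of a non-characteristic module -/

/-- If the hyperplane `t = 0` is non-characteristic for `M` near the origin, then every `u ∈ M`
satisfies a relation `(c + h) u = Q t u`, where `c` is a nonzero constant, `h` has negative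
`V`-degree and commutes with `t`, and `Q` has `V`-degree at most the weight of `t`. -/
theorem NonCharacteristicNearOrigin.exists_relation {n : ℕ} {M : Type*} [AddCommGroup M]
    [Module ℂ M] [Module (Weyl (n + 1)) M] [IsScalarTower ℂ (Weyl (n + 1)) M]
    [Module.Finite (Weyl (n + 1)) M] (hM : NonCharacteristicNearOrigin n M)
    {w : Fin (n + 1) → ℝ} (hw : ∀ i, 0 < w i ∧ w i ≤ w (Fin.last n)) (u : M) :
    ∃ c : ℂ, c ≠ 0 ∧ ∃ δ > 0, ∃ h ∈ Weyl.V w (-δ), Commute (Weyl.x (Fin.last n)) h ∧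
      ∃ Q ∈ Weyl.V w (w (Fin.last n)), c • u + h • u = Q • (Weyl.x (Fin.last n) : Weyl (n + 1)) • u
    := by
  obtain ⟨i₀, hi₀⟩ := Finite.exists_min w
  obtain ⟨g, hg, hM⟩ := hM
  obtain ⟨s, m, hm⟩ := Module.Finite.exists_fin (R := Weyl (n + 1)) (M := M)
  -- the conormal covector `dt` at the origin is not characteristic
  have hz : ((0, Pi.single (Fin.last n) 1) : (Fin (n + 1) → ℂ) × (Fin (n + 1) → ℂ)) ∉
      charVariety (n + 1) M := by
    intro hz
    have := hM _ ⟨⟨rfl, fun i => by simp [(Fin.castSucc_lt_last i).ne]⟩, hz⟩ hg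
    simpa using congrFun this (Fin.last n)
  have hex := Weyl.exists_mem_orderFiltrationOf m hm
  have htop : ⨆ p, Weyl.orderFiltrationOf (n + 1) m p = ⊤ := by
    refine eq_top_iff.2 fun y _ => ?_
    obtain ⟨p, hp⟩ := hex y
    exact Submodule.mem_iSup_of_mem p hp
  have hz' := not_and.1 (not_and.1 (not_exists.1 hz _)
    (Weyl.isGoodFiltration_orderFiltrationOf m)) htop
  push Not at hz'
  obtain ⟨d, q, hq, hL, hq0⟩ := hz'
  rw [Weyl.eval_conormal_eq_coeff hq] at hq0
  set L := Weyl.normalOrder (n + 1) q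
  obtain ⟨p, hp⟩ := hex u
  have hLr : ∀ r : ℕ, L ^ r • u ∈ Weyl.orderFiltrationOf (n + 1) m (p + r * (d - 1)) := by
    intro r
    induction r with
    | zero => simpa using hp
    | succ r ih =>
      rw [pow_succ', mul_smul]
      have := hL _ _ ih
      rwa [show p + r * ((d : ℤ) - 1) + d - 1 = p + (r + 1 : ℕ) * ((d : ℤ) - 1) by
        push_cast; ring] at this
  obtain ⟨c, hc⟩ := Weyl.exists_shift_mem_orderSpan (n := n + 1) m u
  -- for this `r`, the order drop by `r` outweighs the shifts `p` and `c`
  set r := (p + c + 1).toNat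
  obtain ⟨S, hS, hSu⟩ := hc _ _ (hLr r)
  have hS' : p + r * ((d : ℤ) - 1) + c < ((r * d : ℕ) : ℤ) := by
    have := Int.self_le_toNat (p + c + 1)
    push_cast
    rw [mul_sub, mul_one]
    omega
  change S • u = L ^ r • u at hSu
  -- the operator `L ^ r - S` annihilates `u`, and its principal symbol is `q ^ r`
  have hsym := ((Weyl.hasSymbol_normalOrder hq).pow r).2 0 1
  rw [zero_add, mul_one, Prod.pow_fst, Prod.pow_snd, ← Nat.cast_mul] at hsym
  have h1 : Weyl.normalOrderPart (n + 1) 0 1 = 1 := by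
    rw [← MvPolynomial.C_1, ← MvPolynomial.monomial_zero', Weyl.normalOrderPart_monomial]
    simp [← Pi.zero_def]
  rw [h1, mul_one] at hsym
  have hA := Weyl.x_pow_mul_normalOrderPart_mem hw hi₀ (r * d) (q ^ r)
  have hB := Weyl.x_pow_mul_mem_of_lt hw hi₀ (sub_one_lt _) hsym
  have hC := Weyl.x_pow_mul_mem_of_lt hw hi₀ hS' hS
  have hqr := hq.pow r
  rw [smul_eq_mul] at hqr
  have hcoeff : (q ^ r).coeff (Finsupp.single (Sum.inr (Fin.last n)) (r * d)) ≠ 0 := by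
    rw [← Weyl.eval_conormal_eq_coeff hqr, map_pow, Weyl.eval_conormal_eq_coeff hq]
    exact pow_ne_zero _ hq0
  set c₀ : ℂ := (-1) ^ (r * d) * ((r * d).factorial : ℂ) *
    (q ^ r).coeff (Finsupp.single (Sum.inr (Fin.last n)) (r * d)) with hc₀
  have hD := sub_mem (sub_mem hA hB) hC
  obtain ⟨h, ⟨hh, hh'⟩, _, ⟨Q, hQ, rfl⟩, hE⟩ := Submodule.mem_sup.1 hD
  refine ⟨c₀, mul_ne_zero (mul_ne_zero (pow_ne_zero _ (by norm_num))
    (by exact_mod_cast (Nat.factorial_ne_zero _))) hcoeff, w i₀, (hw i₀).1, h, hh,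
    (Subalgebra.mem_centralizer_iff ℂ).1 hh' _ rfl, -Q, neg_mem hQ, ?_⟩
  have hF : Weyl.x (Fin.last n) ^ (r * d) * (L ^ r - S) =
      algebraMap ℂ _ c₀ + h + Q * Weyl.x (Fin.last n) := by
    rw [add_assoc, show h + Q * Weyl.x (Fin.last n) = _ from hE]
    noncomm_ring
  have hG := congrArg (· • u) hF
  simp only [mul_smul, sub_smul, hSu, sub_self, smul_zero, add_smul, algebraMap_smul] at hG
  rw [neg_smul]
  exact eq_neg_of_add_eq_zero_left hG.symm

/-! ### Comparison of the graded modules -/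

namespace VFiltration

theorem mem_lt {n : ℕ} {w : Fin n → ℝ} {M : Type*} [AddCommGroup M] [Module ℂ M]
    [Module (Weyl n) M] (F : VFiltration w M) {k : ℝ} {m : M} :
    m ∈ F.lt k ↔ ∃ j < k, m ∈ F.U j := by
  have : Nonempty (Set.Iio k) := ⟨⟨k - 1, by simp⟩⟩
  refine (Submodule.mem_iSup_of_directed _ ?_).trans (by simp)
  exact Monotone.directed_le fun i j h => F.mono h

section general

variable {n : ℕ} {w : Fin n → ℝ} {M : Type*} [AddCommGroup M] [Module ℂ M] [Module (Weyl n) M]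
  [IsScalarTower ℂ (Weyl n) M] (F : VFiltration w M)

/-- The quotient map `⨁ U_k M T^k → gr^U M`. -/
noncomputable def toGr : F.rees →ₗ[Weyl n] F.Gr := (F.reesLT.submoduleOf F.rees).mkQ

theorem toGr_surjective : Function.Surjective F.toGr := Submodule.mkQ_surjective _

theorem toGr_eq_toGr_iff {f g : F.rees} :
    F.toGr f = F.toGr g ↔ ∀ k, GradedSums.coeff w k (f.1 - g.1) ∈ F.lt k :=
  Submodule.Quotient.eq _

theorem gr_induction {p : F.Gr → Prop} (h0 : p 0) (hadd : ∀ a b, p a → p b → p (a + b))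
    (hsymbol : ∀ (k : ℝ) (m : M) (hm : m ∈ F.U k), p (F.symbol hm)) (a : F.Gr) : p a := by
  obtain ⟨⟨f, hf⟩, rfl⟩ := F.toGr_surjective a
  have key : ∀ (f : ℝ →₀ M) (hf : (show GradedSums w M from f) ∈ F.rees),
      p (F.toGr ⟨f, hf⟩) := by
    intro f
    induction f using Finsupp.induction with
    | zero => intro hf; exact (congrArg p (map_zero _)).mpr h0
    | single_add k m f hk hm ih =>
      intro hf
      have hmk : m ∈ F.U k := by
        have h : (Finsupp.single k m + f) k ∈ F.U k := hf k
        simpa [Finsupp.notMem_support_iff.1 hk] using h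
      have hf' : (show GradedSums w M from f) ∈ F.rees :=
        (Submodule.add_mem_iff_right _ (F.single_mem_rees hmk)).1 hf
      refine (congrArg p (map_add F.toGr
        ⟨_, F.single_mem_rees hmk⟩ ⟨f, hf'⟩)).mpr ?_
      exact hadd _ _ (hsymbol k m hmk) (ih hf')
  exact key f hf

end general

section restrict

variable {n : ℕ} {w : Fin (n + 1) → ℝ} {M : Type*} [AddCommGroup M] [Module ℂ M]
  [Module (Weyl (n + 1)) M] [IsScalarTower ℂ (Weyl (n + 1)) M] (F : VFiltration w M)

/-- If `t m ∈ U_k M`, then the relation `(c + h) m = Q t m` shows that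
`t m ∈ U_{<k} M + t U_{k + w_t} M`. -/
theorem exists_x_last_smul_sub_mem_lt [Module.Finite (Weyl (n + 1)) M]
    (hw : ∀ i, 0 < w i ∧ w i ≤ w (Fin.last n)) (hM : NonCharacteristicNearOrigin n M)
    {k : ℝ} {m : M} (hm : (Weyl.x (Fin.last n) : Weyl (n + 1)) • m ∈ F.U k) :
    ∃ m' ∈ F.U (k + w (Fin.last n)),
      (Weyl.x (Fin.last n) : Weyl (n + 1)) • m - (Weyl.x (Fin.last n) : Weyl (n + 1)) • m' ∈
        F.lt k := by
  obtain ⟨c, hc, δ, hδ, h, hh, hcomm, Q, hQ, hrel⟩ := hM.exists_relation hw m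
  set t : Weyl (n + 1) := Weyl.x (Fin.last n)
  refine ⟨c⁻¹ • Q • t • m, Submodule.smul_mem _ _ ?_, ?_⟩
  · rw [add_comm k]; exact F.smul_mem hQ hm
  · have h1 : t • m - t • c⁻¹ • Q • t • m = -(c⁻¹ • h • t • m) := by
      rw [← hrel, smul_add, smul_smul, inv_mul_cancel₀ hc, one_smul, smul_add,
        smul_algebra_smul_comm, smul_smul t h, hcomm.eq, mul_smul]
      abel
    rw [h1]
    exact neg_mem (Submodule.smul_mem _ _
      (F.mem_lt.2 ⟨-δ + k, by linarith, F.smul_mem hh hm⟩))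

theorem restrict_lt (k : ℝ) : F.restrict.lt k = (F.lt k).map (Restriction.mk n M) := by
  simp only [lt, Submodule.map_iSup]
  rfl

/-- The map `M[T^ℝ] → (i^* M)[T^ℝ]` induced by `M → i^* M`. -/
noncomputable def gradedSumsRestrict : GradedSums w M →ₗ[ℂ]
    GradedSums (fun i : Fin n => w i.castSucc) (Restriction n M) :=
  Finsupp.mapRange.linearMap (Restriction.mk n M)

theorem coeff_gradedSumsRestrict (f : GradedSums w M) (k : ℝ) :
    GradedSums.coeff _ k (gradedSumsRestrict f) = Restriction.mk n M (GradedSums.coeff w k f) :=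
  rfl

theorem gradedSums_ext {n : ℕ} {w : Fin n → ℝ} {M : Type*} [AddCommGroup M] [Module ℂ M]
    {f g : GradedSums w M}
    (h : ∀ k, GradedSums.coeff w k f = GradedSums.coeff w k g) : f = g :=
  Finsupp.ext h

theorem gradedSumsRestrict_smul (P : Weyl n) (f : GradedSums w M) :
    gradedSumsRestrict (Weyl.incl n P • f) = P • gradedSumsRestrict f := by
  refine Weyl.induction (p := fun P => ∀ f : GradedSums w M,
    gradedSumsRestrict (Weyl.incl n P • f) = P • gradedSumsRestrict f) ?_ ?_ ?_ ?_ ?_ P f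
  · intro c f
    rw [AlgHom.commutes, algebraMap_smul, algebraMap_smul, map_smul]
  · intro i f
    refine gradedSums_ext fun k => ?_
    rw [coeff_gradedSumsRestrict, Weyl.incl_x, GradedSums.coeff_x_smul, GradedSums.coeff_x_smul,
      coeff_gradedSumsRestrict, Restriction.incl_smul_mk, Weyl.incl_x]
  · intro i f
    refine gradedSums_ext fun k => ?_
    rw [coeff_gradedSumsRestrict, Weyl.incl_d, GradedSums.coeff_d_smul, GradedSums.coeff_d_smul,
      coeff_gradedSumsRestrict, Restriction.incl_smul_mk, Weyl.incl_d]
  · intro a b ha hb f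
    rw [map_add, add_smul, add_smul, map_add, ha, hb]
  · intro a b ha hb f
    rw [map_mul, mul_smul, mul_smul, ha, hb]

/-- The map `⨁ U_k M T^k → ⨁ U_k (i^* M) T^k` induced by `M → i^* M`. -/
noncomputable def reesRestrict : F.rees →+ F.restrict.rees where
  toFun f := ⟨gradedSumsRestrict f.1, fun k => Submodule.mem_map_of_mem (f.2 k)⟩
  map_zero' := Subtype.ext (map_zero gradedSumsRestrict)
  map_add' f g := Subtype.ext (map_add gradedSumsRestrict f.1 g.1)

theorem reesRestrict_smul (P : Weyl n) (f : F.rees) :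
    F.reesRestrict (Weyl.incl n P • f) = P • F.reesRestrict f :=
  Subtype.ext (gradedSumsRestrict_smul P f.1)

theorem toGr_reesRestrict_single {k : ℝ} {m : M} (hm : m ∈ F.U k) :
    F.restrict.toGr (F.reesRestrict ⟨GradedSums.single w M k m, F.single_mem_rees hm⟩) =
      F.restrict.symbol (Submodule.mem_map_of_mem (f := Restriction.mk n M) hm) :=
  congrArg F.restrict.toGr
    (Subtype.ext (Finsupp.mapRange_single (hf := map_zero (Restriction.mk n M))))

/-- The map `⨁ U_k M T^k → gr^U (i^* M)`. -/
noncomputable def reesToGrRestrict : ScalarRestriction n F.rees →ₗ[Weyl n] F.restrict.Gr where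
  toFun f := F.restrict.toGr (F.reesRestrict f)
  map_add' f g := (congrArg F.restrict.toGr (map_add F.reesRestrict f g)).trans (map_add _ _ _)
  map_smul' P f := (congrArg F.restrict.toGr (F.reesRestrict_smul P f)).trans (map_smul _ _ _)

theorem reesToGrRestrict_eq_zero_iff (f : F.rees) :
    F.reesToGrRestrict f = 0 ↔
      ∀ k, ∃ u ∈ F.lt k, ∃ m : M, GradedSums.coeff w k f.1 =
        u + (Weyl.x (Fin.last n) : Weyl (n + 1)) • m := by
  refine (Submodule.Quotient.mk_eq_zero _).trans (forall_congr' fun k => ?_)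
  change Restriction.mk n M (GradedSums.coeff w k f.1) ∈ F.restrict.lt k ↔ _
  rw [restrict_lt, Submodule.mem_map]
  refine exists_congr fun u => and_congr_right fun _ => ?_
  rw [eq_comm]
  refine (Submodule.Quotient.eq (xLastMul n M)).trans ?_
  refine exists_congr fun m => ?_
  exact sub_eq_iff_eq_add'

theorem reesToGrRestrict_surjective : Function.Surjective F.reesToGrRestrict := by
  intro a
  refine F.restrict.gr_induction (p := fun a => ∃ f, F.reesToGrRestrict f = a)
    ⟨0, map_zero _⟩ ?_ ?_ a
  · rintro _ _ ⟨f, rfl⟩ ⟨g, rfl⟩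
    exact ⟨f + g, map_add _ _ _⟩
  · rintro k _ ⟨m, hm, rfl⟩
    exact ⟨(⟨GradedSums.single w M k m, F.single_mem_rees hm⟩ : F.rees),
      F.toGr_reesRestrict_single hm⟩

/-- The natural map `⨁ U_k M T^k → i^* gr^U M`. -/
noncomputable def reesToRestrictionGr :
    ScalarRestriction n F.rees →ₗ[Weyl n] Restriction n F.Gr where
  toFun f := Restriction.mk n F.Gr (F.toGr f)
  map_add' f g := (congrArg (Restriction.mk n F.Gr) (map_add F.toGr f g)).trans (map_add _ _ _)
  map_smul' P f := congrArg (Restriction.mk n F.Gr) 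
    (map_smul F.toGr (Weyl.incl n P) (show F.rees from f))

theorem reesToRestrictionGr_surjective : Function.Surjective F.reesToRestrictionGr :=
  (Submodule.mkQ_surjective (xLastMul n F.Gr)).comp F.toGr_surjective

theorem reesToRestrictionGr_eq_zero_iff (f : F.rees) :
    F.reesToRestrictionGr f = 0 ↔ ∃ g : F.rees, ∀ k,
      GradedSums.coeff w k (f.1 - (Weyl.x (Fin.last n) : Weyl (n + 1)) • g.1) ∈ F.lt k := by
  refine (Submodule.Quotient.mk_eq_zero (xLastMul n F.Gr)).trans ?_
  refine Iff.trans (?_ : _ ↔ ∃ a : F.Gr, F.toGr f = (Weyl.x (Fin.last n) : Weyl (n + 1)) • a) ?_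
  · rfl
  rw [F.toGr_surjective.exists]
  refine exists_congr fun g => ?_
  rw [← map_smul]
  exact F.toGr_eq_toGr_iff

/-- Both maps out of `⨁ U_k M T^k` have the same kernel. That the kernel of the first is contained
in the kernel of the second is where non-characteristicity enters. -/
theorem ker_reesToGrRestrict_eq [Module.Finite (Weyl (n + 1)) M]
    (hw : ∀ i, 0 < w i ∧ w i ≤ w (Fin.last n)) (hM : NonCharacteristicNearOrigin n M) :
    LinearMap.ker F.reesToGrRestrict = LinearMap.ker F.reesToRestrictionGr := by
  ext f
  change F.reesToGrRestrict f = 0 ↔ F.reesToRestrictionGr f = 0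
  refine (F.reesToGrRestrict_eq_zero_iff f).trans (Iff.trans ?_
    (F.reesToRestrictionGr_eq_zero_iff f).symm)
  set f' : F.rees := f
  clear_value f'
  constructor
  · intro h
    have h' : ∀ k, ∃ m' ∈ F.U (k + w (Fin.last n)),
        GradedSums.coeff w k f'.1 - (Weyl.x (Fin.last n) : Weyl (n + 1)) • m' ∈ F.lt k := by
      intro k
      obtain ⟨u, hu, m, hm⟩ := h k
      have hlt : F.lt k ≤ F.U k := iSup_le fun j => F.mono (le_of_lt j.2)
      have htm : (Weyl.x (Fin.last n) : Weyl (n + 1)) • m ∈ F.U k := by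
        rw [eq_sub_iff_add_eq'.2 hm.symm]
        exact sub_mem (f'.2 k) (hlt hu)
      obtain ⟨m', hm', hlt'⟩ := F.exists_x_last_smul_sub_mem_lt hw hM htm
      refine ⟨m', hm', ?_⟩
      rw [hm, add_sub_assoc]
      exact add_mem hu hlt'
    choose m hm hlt using h'
    classical
    -- the degree `k` part of `f` is corrected by an element of degree `k + w_t`
    let g : ℝ →₀ M := ∑ k ∈ (show ℝ →₀ M from f'.1).support,
      Finsupp.single (k + w (Fin.last n)) (m k)
    have hg : ∀ k, GradedSums.coeff w (k + w (Fin.last n)) (show GradedSums w M from g) =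
        if k ∈ (show ℝ →₀ M from f'.1).support then m k else 0 := by
      intro k
      change g (k + w (Fin.last n)) = _
      simp only [g, Finsupp.finsetSum_apply, Finsupp.single_apply, add_left_inj,
        Finset.sum_ite_eq']
    refine ⟨⟨g, fun k => ?_⟩, fun k => ?_⟩
    · have := hg (k - w (Fin.last n))
      rw [sub_add_cancel] at this
      rw [this]
      split_ifs
      · simpa using hm (k - w (Fin.last n))
      · exact zero_mem _
    · rw [map_sub, GradedSums.coeff_x_smul, hg]
      split_ifs with hk
      · exact hlt k
      · have : GradedSums.coeff w k f'.1 = 0 := Finsupp.notMem_support_iff.1 hk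
        rw [this, smul_zero, sub_zero]
        exact zero_mem _
  · rintro ⟨g, hg⟩ k
    have h := hg k
    rw [map_sub, GradedSums.coeff_x_smul] at h
    exact ⟨_, h, _, (sub_add_cancel _ _).symm⟩

end restrict

end VFiltration

theorem mainTheorem5 (n : ℕ) (w : Fin (n + 1) → ℝ) (hw : ∀ i, 0 < w i ∧ w i ≤ w (Fin.last n))
    (M : Type*) [AddCommGroup M] [Module ℂ M] [Module (Weyl (n + 1)) M]
    [IsScalarTower ℂ (Weyl (n + 1)) M] [Module.Finite (Weyl (n + 1)) M]
    (F : VFiltration w M) (hF : IsGoodFiltration (Weyl.V w) F.U)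
    (hM : NonCharacteristicNearOrigin n M) :
    ∃! e : F.restrict.Gr ≃ₗ[Weyl n] Restriction n F.Gr,
      ∀ (k : ℝ) (m : M) (hm : m ∈ F.U k),
        e (F.restrict.symbol (Submodule.mem_map_of_mem (f := Restriction.mk n M) hm)) =
          Restriction.mk n F.Gr (F.symbol hm) := by
  let e : F.restrict.Gr ≃ₗ[Weyl n] Restriction n F.Gr :=
    (F.reesToGrRestrict.quotKerEquivOfSurjective F.reesToGrRestrict_surjective).symm ≪≫ₗ
      Submodule.quotEquivOfEq _ _ (F.ker_reesToGrRestrict_eq hw hM) ≪≫ₗ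
        F.reesToRestrictionGr.quotKerEquivOfSurjective F.reesToRestrictionGr_surjective
  have he : ∀ f, e (F.reesToGrRestrict f) = F.reesToRestrictionGr f := by
    intro f
    simp only [e, LinearEquiv.trans_apply]
    rw [← LinearMap.quotKerEquivOfSurjective_apply_mk (hf := F.reesToGrRestrict_surjective) _ f,
      LinearEquiv.symm_apply_apply, Submodule.quotEquivOfEq_mk,
      LinearMap.quotKerEquivOfSurjective_apply_mk]
  have hsymbol : ∀ (k : ℝ) (m : M) (hm : m ∈ F.U k),
      e (F.restrict.symbol (Submodule.mem_map_of_mem (f := Restriction.mk n M) hm)) =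
        Restriction.mk n F.Gr (F.symbol hm) := fun k m hm =>
    (congrArg e (F.toGr_reesRestrict_single hm)).symm.trans
      (he (⟨GradedSums.single w M k m, F.single_mem_rees hm⟩ : F.rees))
  refine ⟨e, hsymbol, fun e' he' => LinearEquiv.ext fun a => ?_⟩
  refine F.restrict.gr_induction (p := fun a => e' a = e a) ?_ ?_ ?_ a
  · rw [map_zero, map_zero]
  · intro a b ha hb
    rw [map_add, map_add, ha, hb]
  · rintro k _ ⟨m, hm, rfl⟩
    exact (he' k m hm).trans (hsymbol k m hm).symm
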